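/- All graphs are finite and simple. "$G$ contains $H$" means that $G$ has an induced subgraph isomorphic to $H$, and "$G$ is $H$-free" means that it does not. A path in $G$ is an induced subgraph that is a path; its length is its number of edges and its interior $P^*$ is the set of its vertices other than the two ends. A hole is an induced cycle of length at least four. Two sets are anticomplete if there is no edge between them. A theta consists of two non-adjacent vertices $a,b$ and three paths from $a$ to $b$ of length at least two whose interiors are pairwise disjoint and anticomplete. A pyramid consists of a vertex $a$, a triangle $b_1b_2b_3$ and paths $P_i$ from $a$ to $b_i$ ($i=1,2,3$), of length at least one, at most one of them of length exactly one, pairwise disjoint except for $a$, such that for $i\neq j$ the only edge between $P_i\setminus\{a\}$ and $P_j\setminus\{a\}$ is $b_ib_j$. A prism consists of two triangles $a_1a_2a_3$, $b_1b_2b_3$ and pairwise disjoint paths $P_i$ from $a_i$ to $b_i$, of length at least one, such that for $i\ne j$ the only edges between $P_i$ and $P_j$ are $a_ia_j$ and $b_ib_j$. A pinched prism consists of a hole $H$ of length at least six and a further vertex whose set of neighbours in $H$ induces two disjoint edges with no edge between them. A generalized prism is a prism or a pinched prism. The cube is the graph on $\{a_1,\dots,a_6,b_1,b_2\}$ in which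 $a_1\cdots a_6$ is a hole, in this cyclic order, $b_1$ is adjacent to $a_1,a_3,a_5$, $b_2$ is adjacent to $a_2,a_4,a_6$, and there are no other edges. For a vertex $v$, $N[v]$ is the set consisting of $v$ and its neighbours; for a vertex set $X$, $N[X]$ is the set of vertices in $X$ or with a neighbour in $X$; and $N_W(v)$ is the set of neighbours of $v$ in $W$. For a hole $W$ and a vertex $v\notin W$, a long sector of $(W,v)$ is a path of $W$ with non-empty interior, both of whose ends are adjacent to $v$ and whose interior is anticomplete to $\{v\}$. A wheel in $G$ is a pair $(W,v)$ where $W$ is a hole of $G$ of length at least five, $v\in V(G)\setminus W$ has at least three neighbours in $W$, and $(W,v)$ has at least two long sectors. A wheel $(W,v)$ is optimal if $|N_W(v)|\le |N_{W'}(v)|$ for every wheel $(W',v)$ in $G$ with the same vertex $v$. **Theorem.** Let $G$ be a cube-free (theta, pyramid, generalized prism)-free graph and let $(W,v)$ be an optimal wheel in $G$. Then there is no connected component $D$ of $G\setminus N[v]$ such that $W\subseteq N[D]$. -/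

import Mathlib

open SimpleGraph

/-- `p` is an induced path of `G` (a "path in `G`"). -/
def IsInducedPath {V : Type*} {G : SimpleGraph V} {x y : V} (p : G.Walk x y) : Prop :=
  p.IsPath ∧ p.IsChordless

/-- The interior of a path from `x` to `y`: its vertices other than the two ends. -/
def pathInterior {V : Type*} {G : SimpleGraph V} {x y : V} (p : G.Walk x y) : Set V :=
  {z | z ∈ p.support ∧ z ≠ x ∧ z ≠ y}

/-- `W` is (the vertex set of) a hole of `G`: an induced cycle of length at least four. -/
def IsHole {V : Type*} (G : SimpleGraph V) (W : Set V) : Prop :=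
  ∃ (u : V) (c : G.Walk u u), c.IsCycle ∧ c.IsChordless ∧ 4 ≤ c.length ∧ {x | x ∈ c.support} = W

/-- `G` contains a theta as an induced subgraph: two non-adjacent vertices `a`, `b` and three
paths from `a` to `b` of length at least two, whose interiors are pairwise disjoint and
anticomplete. The theta is the subgraph induced on the union of the three paths. -/
def ContainsTheta {V : Type*} (G : SimpleGraph V) : Prop :=
  ∃ (a b : V) (P : Fin 3 → G.Walk a b),
    ¬ G.Adj a b ∧
    (∀ i, IsInducedPath (P i) ∧ 2 ≤ (P i).length) ∧
    ∀ i j, i ≠ j → ∀ x ∈ pathInterior (P i), ∀ y ∈ pathInterior (P j), x ≠ y ∧ ¬ G.Adj x y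

/-- `G` contains a pyramid as an induced subgraph: an apex `a`, a triangle `b 0, b 1, b 2`, and
paths from `a` to each `b i`, of length at least one and at most one of them of length exactly
one, disjoint apart from `a`, such that the only edges between different paths minus `a` are
those of the triangle. -/
def ContainsPyramid {V : Type*} (G : SimpleGraph V) : Prop :=
  ∃ (a : V) (b : Fin 3 → V) (P : ∀ i, G.Walk a (b i)),
    (∀ i j, i ≠ j → G.Adj (b i) (b j)) ∧
    (∀ i, IsInducedPath (P i) ∧ 1 ≤ (P i).length) ∧
    (∀ i j, (P i).length = 1 → (P j).length = 1 → i = j) ∧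
    ∀ i j, i ≠ j → ∀ x ∈ (P i).support, x ≠ a → ∀ y ∈ (P j).support, y ≠ a →
      x ≠ y ∧ (G.Adj x y → x = b i ∧ y = b j)

/-- `G` contains a prism as an induced subgraph: two triangles `a 0, a 1, a 2` and
`b 0, b 1, b 2`, and pairwise disjoint paths from `a i` to `b i` of length at least one, such
that the only edges between different paths are those of the two triangles. -/
def ContainsPrism {V : Type*} (G : SimpleGraph V) : Prop :=
  ∃ (a b : Fin 3 → V) (P : ∀ i, G.Walk (a i) (b i)),
    (∀ i j, i ≠ j → G.Adj (a i) (a j)) ∧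
    (∀ i j, i ≠ j → G.Adj (b i) (b j)) ∧
    (∀ i, IsInducedPath (P i) ∧ 1 ≤ (P i).length) ∧
    ∀ i j, i ≠ j → ∀ x ∈ (P i).support, ∀ y ∈ (P j).support,
      x ≠ y ∧ (G.Adj x y → (x = a i ∧ y = a j) ∨ (x = b i ∧ y = b j))

/-- `G` contains a pinched prism as an induced subgraph: a hole `H` of length at least six and a
vertex `c` outside `H` whose neighbours in `H` are the ends of two disjoint edges `x₁y₁`, `x₂y₂`
with no edge between them (an induced two-edge matching). -/
def ContainsPinchedPrism {V : Type*} (G : SimpleGraph V) : Prop :=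
  ∃ (H : Set V) (c x₁ y₁ x₂ y₂ : V),
    IsHole G H ∧ 6 ≤ H.ncard ∧ c ∉ H ∧
    G.neighborSet c ∩ H = {x₁, y₁, x₂, y₂} ∧
    G.Adj x₁ y₁ ∧ G.Adj x₂ y₂ ∧
    (∀ s ∈ ({x₁, y₁} : Set V), ∀ t ∈ ({x₂, y₂} : Set V), s ≠ t ∧ ¬ G.Adj s t)

/-- `G` contains a generalized prism: a prism or a pinched prism. -/
def ContainsGeneralizedPrism {V : Type*} (G : SimpleGraph V) : Prop :=
  ContainsPrism G ∨ ContainsPinchedPrism G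

/-- The cube: `inl 0, …, inl 5` is a hole of length six, `inr 0` is complete to the even and
`inr 1` to the odd vertices of that hole, and there are no other edges. -/
def cube : SimpleGraph (Fin 6 ⊕ Fin 2) where
  Adj
    | .inl i, .inl j => (cycleGraph 6).Adj i j
    | .inl i, .inr b => i.val % 2 = b.val
    | .inr b, .inl i => i.val % 2 = b.val
    | .inr _, .inr _ => False
  symm := ⟨by
    rintro (i | b) (j | c) h
    · exact h.symm
    · exact h
    · exact h
    · exact h⟩
  loopless := ⟨by
    rintro (i | b) h
    · exact (cycleGraph 6).loopless.irrefl i h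
    · exact h⟩

/-- The class of (theta, pyramid, generalized prism)-free graphs. -/
def InClassC {V : Type*} (G : SimpleGraph V) : Prop :=
  ¬ ContainsTheta G ∧ ¬ ContainsPyramid G ∧ ¬ ContainsGeneralizedPrism G

/-- The class of cube-free (theta, pyramid, generalized prism)-free graphs. -/
def InClassCStar {V : Type*} (G : SimpleGraph V) : Prop :=
  InClassC G ∧ ¬ cube.IsIndContained G

/-- `S` is (the vertex set of) a long sector of `(W, v)`: a path contained in `W` with both ends
adjacent to `v`, with non-empty interior, and with `v` anticomplete to the interior. -/
def IsLongSector {V : Type*} (G : SimpleGraph V) (W : Set V) (v : V) (S : Set V) : Prop :=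
  S ⊆ W ∧ ∃ (x y : V) (p : G.Walk x y), IsInducedPath p ∧ {z | z ∈ p.support} = S ∧
    G.Adj v x ∧ G.Adj v y ∧ (pathInterior p).Nonempty ∧ ∀ z ∈ pathInterior p, ¬ G.Adj v z

/-- `(W, v)` is a wheel in `G`: `W` is a hole of length at least five, `v` is a vertex outside `W`
with at least three neighbours in `W`, and `(W, v)` has at least two long sectors. -/
def IsWheel {V : Type*} (G : SimpleGraph V) (W : Set V) (v : V) : Prop :=
  IsHole G W ∧ 5 ≤ W.ncard ∧ v ∉ W ∧ 3 ≤ (G.neighborSet v ∩ W).ncard ∧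
    ∃ S T : Set V, S ≠ T ∧ IsLongSector G W v S ∧ IsLongSector G W v T

/-- `(W, v)` is an optimal wheel: it minimises the number of neighbours of `v` in the hole among
all wheels with the same hub `v`. -/
def IsOptimalWheel {V : Type*} (G : SimpleGraph V) (W : Set V) (v : V) : Prop :=
  IsWheel G W v ∧ ∀ W' : Set V, IsWheel G W' v →
    (G.neighborSet v ∩ W).ncard ≤ (G.neighborSet v ∩ W').ncard

/-- The closed neighbourhood `N[v]` of a vertex. -/
def closedNbhd {V : Type*} (G : SimpleGraph V) (v : V) : Set V :=
  insert v (G.neighborSet v)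

/-- The closed neighbourhood `N[X]` of a set of vertices. -/
def closedNbhdSet {V : Type*} (G : SimpleGraph V) (X : Set V) : Set V :=
  X ∪ {w | ∃ x ∈ X, G.Adj x w}

/-!
The rim of the wheel is parametrised by an `n`-periodic sequence `w : ℤ → V` (`IsCyc`), so that
rotations become translations of the index and every statement about arcs, sectors and adjacency on
the rim is linear arithmetic in the indices. The rim vertices adjacent to the hub `v` are called
spokes. A connected set disjoint from the rim and from `N[v]` (`Away`) is called local if all its
neighbours on the rim lie in one sector (`Local`).

Optimality enters only once. If a connected set `P` is attached to the two ends of an arc and not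
to its interior, then the rim can be rerouted through `P`; unless `P` is local, the new hole would
be a wheel with fewer spokes or would give a theta as soon as the arc carries two spokes with a
non-spoke between them (`Wheel.no_spoke_outside`). Hence on such an arc the spokes are consecutive
(`Wheel.spokes_consecutive`). The second tool concerns a long sector: a vertex outside the rim that
can be linked to the hub away from this sector has at most one end of the sector as a neighbour on
it (`Wheel.false_of_anti`), and such links exist because some spoke is not near the sector
(`Wheel.exists_far_spoke`).

With these tools, a single vertex that is not local is a clone of a spoke `x`: it is adjacent to
both rim neighbours of `x` and to no other rim vertex except possibly `x`. Moreover the two sectors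
at `x` are the only long ones, and the other spokes form an arc (`Wheel.exists_isClone`); the cube
is one of the configurations that have to be excluded here. A path that is not local but becomes
local when either end is removed also forces two long sectors meeting in a spoke `x`, with the path
minus its last vertex attached to `x` or next to it (`Wheel.exists_isLone_of_split`).

Now suppose that a component `D` of `G ∖ N[v]` has the rim in its closed neighbourhood. A walk in
`D` from the interior of one long sector to the rest of the rim shows that there is an isolated
spoke `x` as above (`Wheel.exists_isLone`). An interior vertex of the opposite arc of spokes has a
neighbour in `D`, from which a walk in `D` leads to the rest of the rim. The initial segments of
this walk that are local are attached only to one edge of the opposite arc, so they do not come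
near `x`, and the first one that is not local must end in a clone of `x`. Replacing `x` by the
clone gives a hole, and the walk from the clone to the opposite edge makes it a theta or a pyramid
(`Wheel.false_of_isClone`).
-/

namespace OptimalWheel

variable {V : Type*} {G : SimpleGraph V}

/-! ### Walks inside a set of vertices -/

/-- `x` and `y` are joined by a walk of `G` all of whose vertices lie in `A`. -/
def Linked (G : SimpleGraph V) (A : Set V) (x y : V) : Prop :=
  ∃ p : G.Walk x y, ∀ z ∈ p.support, z ∈ A

theorem Linked.refl {A : Set V} {x : V} (hx : x ∈ A) : Linked G A x x :=
  ⟨.nil, by simpa using hx⟩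

theorem Linked.symm {A : Set V} {x y : V} (h : Linked G A x y) : Linked G A y x := by
  obtain ⟨p, hp⟩ := h
  exact ⟨p.reverse, by simpa using hp⟩

theorem Linked.trans {A : Set V} {x y z : V} (h : Linked G A x y) (h' : Linked G A y z) :
    Linked G A x z := by
  obtain ⟨p, hp⟩ := h
  obtain ⟨q, hq⟩ := h'
  refine ⟨p.append q, fun t ht => ?_⟩
  rw [Walk.mem_support_append_iff] at ht
  exact ht.elim (hp t) (hq t)

theorem Linked.mono {A B : Set V} {x y : V} (h : Linked G A x y) (hAB : A ⊆ B) :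
    Linked G B x y := by
  obtain ⟨p, hp⟩ := h
  exact ⟨p, fun z hz => hAB (hp z hz)⟩

theorem Linked.of_adj {A : Set V} {x y : V} (hx : x ∈ A) (hy : y ∈ A) (h : G.Adj x y) :
    Linked G A x y :=
  ⟨.cons h .nil, by simp [hx, hy]⟩

theorem Linked.left_mem {A : Set V} {x y : V} (h : Linked G A x y) : x ∈ A := by
  obtain ⟨p, hp⟩ := h
  exact hp _ p.start_mem_support

/-- A predicate that passes along edges inside `A` passes along links in `A`. -/
theorem Linked.induct {A : Set V} {Q : V → Prop} {x y : V} (h : Linked G A x y)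
    (step : ∀ s ∈ A, ∀ t ∈ A, G.Adj s t → Q s → Q t) (hx : Q x) : Q y := by
  obtain ⟨p, hp⟩ := h
  induction p with
  | nil => exact hx
  | cons hadj q ih =>
    exact ih (step _ (hp _ (Walk.start_mem_support _)) _ (hp _ (by simp)) hadj hx)
      fun z hz => hp z (by simp [hz])

theorem walk_of_seq (f : ℕ → V) (t : ℕ) (hf : ∀ m < t, G.Adj (f m) (f (m + 1))) :
    ∃ p : G.Walk (f 0) (f t), p.length = t ∧ ∀ m ≤ t, p.getVert m = f m := by
  induction t generalizing f with
  | zero => exact ⟨.nil, rfl, fun m hm => by simp [Nat.le_zero.mp hm]⟩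
  | succ t ih =>
    obtain ⟨p, hl, hp⟩ := ih (fun m => f (m + 1)) fun m hm => hf (m + 1) (by omega)
    refine ⟨.cons (hf 0 (by omega)) p, by simp [hl], fun m hm => ?_⟩
    cases m with
    | zero => simp
    | succ m => simpa using hp m (by omega)

theorem support_eq_of_getVert {f : ℕ → V} {t : ℕ} {x y : V} {p : G.Walk x y}
    (hl : p.length = t) (hp : ∀ m ≤ t, p.getVert m = f m) (z : V) :
    z ∈ p.support ↔ ∃ m ≤ t, f m = z := by
  rw [Walk.mem_support_iff_exists_getVert]
  constructor
  · rintro ⟨m, rfl, hm⟩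
    exact ⟨m, by omega, (hp m (by omega)).symm⟩
  · rintro ⟨m, hm, rfl⟩
    exact ⟨m, hp m hm, by omega⟩

theorem linked_of_seq {A : Set V} (f : ℕ → V) {s t : ℕ} (hst : s ≤ t)
    (hf : ∀ m, s ≤ m → m < t → G.Adj (f m) (f (m + 1))) (hA : ∀ m, s ≤ m → m ≤ t → f m ∈ A) :
    Linked G A (f s) (f t) := by
  induction t, hst using Nat.le_induction with
  | base => exact .refl (hA s le_rfl le_rfl)
  | succ t hst ih =>
    exact (ih (fun m h1 h2 => hf m h1 (by omega)) (fun m h1 h2 => hA m h1 (by omega))).trans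
      (.of_adj (hA t hst (by omega)) (hA _ (by omega) le_rfl) (hf t hst (by omega)))

theorem Linked.exists_seq {A : Set V} {x y : V} (h : Linked G A x y) :
    ∃ (f : ℕ → V) (t : ℕ), f 0 = x ∧ f t = y ∧ (∀ m < t, G.Adj (f m) (f (m + 1))) ∧
      ∀ m ≤ t, f m ∈ A := by
  obtain ⟨p, hp⟩ := h
  exact ⟨p.getVert, p.length, by simp, by simp, fun m hm => p.adj_getVert_succ hm,
    fun m _ => hp _ (p.getVert_mem_support m)⟩

/-- A shortest walk inside a set is an induced path. -/
theorem Linked.exists_isInducedPath {A : Set V} {x y : V} (h : Linked G A x y) :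
    ∃ p : G.Walk x y, IsInducedPath p ∧ ∀ z ∈ p.support, z ∈ A := by
  classical
  have hex : ∃ k, ∃ p : G.Walk x y, (∀ z ∈ p.support, z ∈ A) ∧ p.length = k := by
    obtain ⟨p, hp⟩ := h
    exact ⟨_, p, hp, rfl⟩
  obtain ⟨p, hpA, hpl⟩ := Nat.find_spec hex
  have hmin : ∀ q : G.Walk x y, (∀ z ∈ q.support, z ∈ A) → p.length ≤ q.length := by
    intro q hq
    rw [hpl]
    exact Nat.find_min' hex ⟨q, hq, rfl⟩
  refine ⟨p, ⟨?_, ?_⟩, hpA⟩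
  · have := hmin p.bypass fun z hz => hpA z (p.support_bypass_subset_support hz)
    rw [← Walk.bypass_eq_self_of_length_le_length_bypass p this]
    exact p.bypass_isPath
  · rw [Walk.isChordless_iff_forall_mem_edges]
    have key : ∀ i j, i < j → j ≤ p.length → G.Adj (p.getVert i) (p.getVert j) → j = i + 1 := by
      intro i j hij hj hadj
      have := hmin ((p.take i).append (.cons hadj (p.drop j))) (by
        intro z hz
        rw [Walk.mem_support_append_iff, Walk.support_cons, List.mem_cons] at hz
        rcases hz with hz | rfl | hz
        · exact hpA z ((p.isSubwalk_take i).support_subset hz)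
        · exact hpA _ (p.getVert_mem_support i)
        · exact hpA z ((p.isSubwalk_drop j).support_subset hz))
      simp only [Walk.length_append, Walk.length_cons, Walk.take_length, Walk.drop_length] at this
      omega
    have key2 : ∀ i, i + 1 ≤ p.length → s(p.getVert i, p.getVert (i + 1)) ∈ p.edges := by
      intro i hi
      exact (Walk.mk_mem_edges_iff_exists p).mpr ⟨i, hi, rfl⟩
    intro u' v' hu hv hadj
    obtain ⟨i, rfl, hi⟩ := Walk.mem_support_iff_exists_getVert.mp hu
    obtain ⟨j, rfl, hj⟩ := Walk.mem_support_iff_exists_getVert.mp hv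
    rcases lt_trichotomy i j with hij | rfl | hij
    · obtain rfl := key i j hij hj hadj
      exact key2 i hj
    · exact absurd hadj (G.irrefl)
    · obtain rfl := key j i hij hi hadj.symm
      rw [Sym2.eq_swap]
      exact key2 j hi

/-! ### Recognising three-path configurations -/

/-- `A` and `B` are disjoint and there is no edge of `G` between them. -/
def Anti (G : SimpleGraph V) (A B : Set V) : Prop :=
  ∀ x ∈ A, ∀ y ∈ B, x ≠ y ∧ ¬ G.Adj x y

theorem Anti.symm {A B : Set V} (h : Anti G A B) : Anti G B A :=
  fun x hx y hy => ⟨(h y hy x hx).1.symm, fun hadj => (h y hy x hx).2 hadj.symm⟩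

/-- `A` and `B` are disjoint and the only possible edge of `G` between them is `rs`. -/
def AntiExcept (G : SimpleGraph V) (A B : Set V) (r s : V) : Prop :=
  ∀ x ∈ A, ∀ y ∈ B, x ≠ y ∧ (G.Adj x y → x = r ∧ y = s)

theorem forall_ne_fin_three {Q : Fin 3 → Fin 3 → Prop} (symm : ∀ i j, Q i j → Q j i)
    (h01 : Q 0 1) (h02 : Q 0 2) (h12 : Q 1 2) (i j : Fin 3) (hij : i ≠ j) : Q i j := by
  fin_cases i <;> fin_cases j
  all_goals first | exact absurd rfl hij | assumption | (apply symm; assumption)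

/-- Two non-adjacent vertices linked through three pairwise anticomplete sets form a theta with
shortest paths through these sets. -/
theorem containsTheta_of_sets {a b : V} {A B C : Set V} (hne : a ≠ b) (hab : ¬ G.Adj a b)
    (hA : Linked G (insert a (insert b A)) a b) (hB : Linked G (insert a (insert b B)) a b)
    (hC : Linked G (insert a (insert b C)) a b)
    (hAB : Anti G A B) (hAC : Anti G A C) (hBC : Anti G B C) : ContainsTheta G := by
  have hL : ∀ i : Fin 3, Linked G (insert a (insert b (![A, B, C] i))) a b := by
    intro i; fin_cases i
    · exact hA
    · exact hB
    · exact hC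
  choose P hP hPA using fun i => (hL i).exists_isInducedPath
  refine ⟨a, b, P, hab, fun i => ⟨hP i, ?_⟩, ?_⟩
  · rcases Nat.lt_or_ge (P i).length 2 with h | h
    · interval_cases hl : (P i).length
      · exact absurd (Walk.eq_of_length_eq_zero hl) hne
      · exact absurd (Walk.adj_of_length_eq_one hl) hab
    · exact h
  · have hin : ∀ i, ∀ x ∈ pathInterior (P i), x ∈ (![A, B, C] i) := by
      rintro i x ⟨hx, h1, h2⟩
      simpa [h1, h2] using hPA i x hx
    have hanti : ∀ i j, i ≠ j → Anti G (![A, B, C] i) (![A, B, C] j) :=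
      forall_ne_fin_three (fun i j h => h.symm) hAB hAC hBC
    exact fun i j hij x hx y hy => hanti i j hij x (hin i x hx) y (hin j y hy)

theorem containsPyramid_of_sets {a b₁ b₂ b₃ : V} {A B C : Set V}
    (h₁₂ : G.Adj b₁ b₂) (h₁₃ : G.Adj b₁ b₃) (h₂₃ : G.Adj b₂ b₃)
    (haA : a ∉ A) (haB : a ∉ B) (haC : a ∉ C) (hbA : b₁ ∈ A) (hbB : b₂ ∈ B) (hbC : b₃ ∈ C)
    (hA : Linked G (insert a A) a b₁) (hB : Linked G (insert a B) a b₂)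
    (hC : Linked G (insert a C) a b₃)
    (n₁₂ : ¬ (G.Adj a b₁ ∧ G.Adj a b₂)) (n₁₃ : ¬ (G.Adj a b₁ ∧ G.Adj a b₃))
    (n₂₃ : ¬ (G.Adj a b₂ ∧ G.Adj a b₃))
    (hAB : AntiExcept G A B b₁ b₂) (hAC : AntiExcept G A C b₁ b₃)
    (hBC : AntiExcept G B C b₂ b₃) : ContainsPyramid G := by
  have hL : ∀ i : Fin 3, Linked G (insert a (![A, B, C] i)) a (![b₁, b₂, b₃] i) := by
    intro i; fin_cases i
    · exact hA
    · exact hB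
    · exact hC
  choose P hP hPA using fun i => (hL i).exists_isInducedPath
  refine ⟨a, ![b₁, b₂, b₃], P, ?_, fun i => ⟨hP i, ?_⟩, ?_, ?_⟩
  · exact forall_ne_fin_three (fun i j h => h.symm) h₁₂ h₁₃ h₂₃
  · rw [Nat.one_le_iff_ne_zero]
    intro h0
    have := Walk.eq_of_length_eq_zero h0
    fin_cases i
    · exact haA (this ▸ hbA)
    · exact haB (this ▸ hbB)
    · exact haC (this ▸ hbC)
  · intro i j hi hj
    by_contra hij
    have hi' := Walk.adj_of_length_eq_one hi
    have hj' := Walk.adj_of_length_eq_one hj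
    exact forall_ne_fin_three
      (Q := fun i j => ¬ (G.Adj a (![b₁, b₂, b₃] i) ∧ G.Adj a (![b₁, b₂, b₃] j)))
      (fun i j h h' => h h'.symm) n₁₂ n₁₃ n₂₃ i j hij ⟨hi', hj'⟩
  · have hin : ∀ i, ∀ x ∈ (P i).support, x ≠ a → x ∈ (![A, B, C] i) := by
      intro i x hx h1
      simpa [h1] using hPA i x hx
    have hanti : ∀ i j, i ≠ j → AntiExcept G (![A, B, C] i) (![A, B, C] j)
        (![b₁, b₂, b₃] i) (![b₁, b₂, b₃] j) :=
      forall_ne_fin_three (fun i j h x hx y hy =>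
        ⟨(h y hy x hx).1.symm, fun e => ((h y hy x hx).2 e.symm).symm⟩) hAB hAC hBC
    exact fun i j hij x hx hxa y hy hya => hanti i j hij x (hin i x hx hxa) y (hin j y hy hya)

theorem containsPrism_of_sets {a₁ a₂ a₃ b₁ b₂ b₃ : V} {A B C : Set V}
    (h₁₂ : G.Adj b₁ b₂) (h₁₃ : G.Adj b₁ b₃) (h₂₃ : G.Adj b₂ b₃)
    (k₁₂ : G.Adj a₁ a₂) (k₁₃ : G.Adj a₁ a₃) (k₂₃ : G.Adj a₂ a₃)
    (n₁ : a₁ ≠ b₁) (n₂ : a₂ ≠ b₂) (n₃ : a₃ ≠ b₃)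
    (hA : Linked G A a₁ b₁) (hB : Linked G B a₂ b₂) (hC : Linked G C a₃ b₃)
    (hAB : ∀ x ∈ A, ∀ y ∈ B, x ≠ y ∧ (G.Adj x y → (x = a₁ ∧ y = a₂) ∨ (x = b₁ ∧ y = b₂)))
    (hAC : ∀ x ∈ A, ∀ y ∈ C, x ≠ y ∧ (G.Adj x y → (x = a₁ ∧ y = a₃) ∨ (x = b₁ ∧ y = b₃)))
    (hBC : ∀ x ∈ B, ∀ y ∈ C, x ≠ y ∧ (G.Adj x y → (x = a₂ ∧ y = a₃) ∨ (x = b₂ ∧ y = b₃))) :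
    ContainsPrism G := by
  have hL : ∀ i : Fin 3, Linked G (![A, B, C] i) (![a₁, a₂, a₃] i) (![b₁, b₂, b₃] i) := by
    intro i; fin_cases i
    · exact hA
    · exact hB
    · exact hC
  choose P hP hPA using fun i => (hL i).exists_isInducedPath
  refine ⟨![a₁, a₂, a₃], ![b₁, b₂, b₃], P, ?_, ?_, fun i => ⟨hP i, ?_⟩, ?_⟩
  · exact forall_ne_fin_three (fun i j h => h.symm) k₁₂ k₁₃ k₂₃
  · exact forall_ne_fin_three (fun i j h => h.symm) h₁₂ h₁₃ h₂₃
  · rw [Nat.one_le_iff_ne_zero]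
    intro h0
    have := Walk.eq_of_length_eq_zero h0
    fin_cases i
    · exact n₁ this
    · exact n₂ this
    · exact n₃ this
  · have hanti : ∀ i j, i ≠ j → ∀ x ∈ (![A, B, C] i), ∀ y ∈ (![A, B, C] j), x ≠ y ∧
        (G.Adj x y → (x = ![a₁, a₂, a₃] i ∧ y = ![a₁, a₂, a₃] j) ∨
          (x = ![b₁, b₂, b₃] i ∧ y = ![b₁, b₂, b₃] j)) := by
      refine forall_ne_fin_three (fun i j h x hx y hy =>
        ⟨(h y hy x hx).1.symm, fun e => ?_⟩) hAB hAC hBC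
      exact ((h y hy x hx).2 e.symm).imp And.symm And.symm
    exact fun i j hij x hx y hy => hanti i j hij x (hPA i x hx) y (hPA j y hy)

/-! ### Periodic parametrisations of holes -/

theorem dvd_iff_of_abs_le {n d : ℤ} (hn : 4 ≤ n) (h₁ : -(n + 1) ≤ d) (h₂ : d ≤ n + 1) :
    n ∣ d ↔ d = 0 ∨ d = n ∨ d = -n := by
  constructor
  · rintro ⟨k, rfl⟩
    have hk₁ : -2 < k := by by_contra! h; nlinarith
    have hk₂ : k < 2 := by by_contra! h; nlinarith
    obtain rfl | rfl | rfl : k = -1 ∨ k = 0 ∨ k = 1 := by omega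
    · right; right; ring
    · left; ring
    · right; left; ring
  · rintro (rfl | rfl | rfl)
    · exact dvd_zero _
    · exact dvd_rfl
    · exact (dvd_neg.mpr dvd_rfl)

/-- `w` runs `n`-periodically around a hole of length `n`. Using all integers as indices, every
rotation of the hole becomes a translation of the index, and inside a window of length `n` both
equality and adjacency of vertices are linear conditions on the indices. -/
structure IsCyc (G : SimpleGraph V) (w : ℤ → V) (n : ℤ) : Prop where
  four_le : 4 ≤ n
  eq_iff_dvd : ∀ i j, w i = w j ↔ n ∣ j - i
  adj_iff_dvd : ∀ i j, G.Adj (w i) (w j) ↔ n ∣ j - i - 1 ∨ n ∣ j - i + 1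

namespace IsCyc

variable {w : ℤ → V} {n : ℤ}

theorem eq_iff (h : IsCyc G w n) {i j : ℤ} (h₁ : i ≤ j + n) (h₂ : j ≤ i + n) :
    w i = w j ↔ i = j ∨ i = j + n ∨ j = i + n := by
  rw [h.eq_iff_dvd, dvd_iff_of_abs_le h.four_le (by omega) (by omega)]
  omega

theorem adj_iff (h : IsCyc G w n) {i j : ℤ} (h₁ : i ≤ j + n) (h₂ : j ≤ i + n) :
    G.Adj (w i) (w j) ↔ j = i + 1 ∨ i = j + 1 ∨ j = i + n - 1 ∨ i = j + n - 1 := by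
  have := h.four_le
  rw [h.adj_iff_dvd, dvd_iff_of_abs_le h.four_le (by omega) (by omega),
    dvd_iff_of_abs_le h.four_le (by omega) (by omega)]
  omega

theorem adj_succ (h : IsCyc G w n) (i : ℤ) : G.Adj (w i) (w (i + 1)) := by
  rw [h.adj_iff_dvd]
  left
  simp

theorem add_period (h : IsCyc G w n) (i : ℤ) : w (i + n) = w i :=
  (h.eq_iff_dvd _ _).mpr ⟨-1, by ring⟩

theorem sub_period (h : IsCyc G w n) (i : ℤ) : w (i - n) = w i :=
  (h.eq_iff_dvd _ _).mpr ⟨1, by ring⟩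

theorem reflect (h : IsCyc G w n) : IsCyc G (fun i => w (-i)) n where
  four_le := h.four_le
  eq_iff_dvd i j := by
    rw [h.eq_iff_dvd, ← dvd_neg]
    ring_nf
  adj_iff_dvd i j := by
    rw [h.adj_iff_dvd, or_comm, ← dvd_neg, ← dvd_neg (b := -j - -i - 1)]
    ring_nf

theorem range_reflect (w : ℤ → V) : Set.range (fun i => w (-i)) = Set.range w := by
  ext z
  constructor
  · rintro ⟨i, rfl⟩
    exact ⟨-i, rfl⟩
  · rintro ⟨i, rfl⟩
    exact ⟨-i, by simp⟩

/-- Every index can be moved into a given window of length `n`. -/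
theorem exists_window (h : IsCyc G w n) (c i : ℤ) : ∃ j, c ≤ j ∧ j < c + n ∧ w j = w i := by
  have hn := h.four_le
  refine ⟨c + (i - c) % n, ?_, ?_, ?_⟩
  · have := Int.emod_nonneg (i - c) (by omega : n ≠ 0)
    omega
  · have := Int.emod_lt_of_pos (i - c) (by omega : 0 < n)
    omega
  · rw [h.eq_iff_dvd]
    refine ⟨(i - c) / n, ?_⟩
    have := Int.emod_add_mul_ediv (i - c) n
    omega

theorem of_window (f : ℤ → V) (hn : 4 ≤ n)
    (heq : ∀ i j, 0 ≤ i → i < j → j < n → f i ≠ f j)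
    (hadj : ∀ i j, 0 ≤ i → i < j → j < n →
      (G.Adj (f i) (f j) ↔ j = i + 1 ∨ i = 0 ∧ j = n - 1)) :
    IsCyc G (fun i => f (i % n)) n := by
  have key : ∀ i j k : ℤ, n ∣ j - i + k ↔ n ∣ j % n - i % n + k := by
    intro i j k
    have h₁ := Int.emod_add_mul_ediv i n
    have h₂ := Int.emod_add_mul_ediv j n
    have : j - i + k = (j % n - i % n + k) + n * (j / n - i / n) := by
      rw [mul_sub]; omega
    rw [this, dvd_add_left (dvd_mul_right _ _)]
  have b₁ : ∀ i : ℤ, 0 ≤ i % n := fun i => Int.emod_nonneg _ (by omega)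
  have b₂ : ∀ i : ℤ, i % n < n := fun i => Int.emod_lt_of_pos _ (by omega)
  refine ⟨hn, fun i j => ?_, fun i j => ?_⟩
  · have := key i j 0
    simp only [add_zero] at this
    rw [this]
    have i₁ := b₁ i; have i₂ := b₂ i; have j₁ := b₁ j; have j₂ := b₂ j
    generalize i % n = a at *
    generalize j % n = b at *
    rw [dvd_iff_of_abs_le hn (by omega) (by omega)]
    rcases lt_trichotomy a b with hab | rfl | hab
    · simp only [heq a b i₁ hab j₂, false_iff]; omega
    · simp
    · simp only [(heq b a j₁ hab i₂).symm, false_iff]; omega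
  · have h₁ := key i j 1
    have h₂ := key i j (-1)
    rw [sub_eq_add_neg _ (1 : ℤ), h₁, h₂]
    have i₁ := b₁ i; have i₂ := b₂ i; have j₁ := b₁ j; have j₂ := b₂ j
    generalize i % n = a at *
    generalize j % n = b at *
    rw [dvd_iff_of_abs_le hn (by omega) (by omega), dvd_iff_of_abs_le hn (by omega) (by omega)]
    rcases lt_trichotomy a b with hab | rfl | hab
    · rw [hadj a b i₁ hab j₂]; omega
    · simp only [SimpleGraph.irrefl, false_iff]; omega
    · rw [G.adj_comm, hadj b a j₁ hab i₂]; omega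

/-! ### Arcs of a hole -/

theorem linked_arc (h : IsCyc G w n) {A : Set V} {i j : ℤ} (hij : i ≤ j)
    (hA : ∀ m, i ≤ m → m ≤ j → w m ∈ A) : Linked G A (w i) (w j) := by
  have := linked_of_seq (G := G) (A := A) (fun m : ℕ => w (i + m)) (Nat.zero_le (j - i).toNat)
    (fun m _ _ => by simpa [add_assoc] using h.adj_succ (i + m))
    (fun m _ hm => hA _ (by omega) (by omega))
  have e : i + ((j - i).toNat : ℤ) = j := by omega
  simpa only [e, Nat.cast_zero, add_zero] using this

theorem anti_arc (h : IsCyc G w n) {i j k l : ℤ} (h₁ : j + 2 ≤ k) (h₂ : l + 2 ≤ i + n) :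
    Anti G (w '' Set.Icc i j) (w '' Set.Icc k l) := by
  have := h.four_le
  rintro _ ⟨a, ⟨a₁, a₂⟩, rfl⟩ _ ⟨b, ⟨b₁, b₂⟩, rfl⟩
  rw [Ne, h.eq_iff (by omega) (by omega), h.adj_iff (by omega) (by omega)]
  omega

end IsCyc

/-! ### Holes and wheels in terms of indices -/

theorem _root_.IsInducedPath.of_seq (f : ℕ → V) (t : ℕ) (hne : ∀ i j, i < j → j ≤ t → f i ≠ f j)
    (hadj : ∀ i j, i < j → j ≤ t → (G.Adj (f i) (f j) ↔ j = i + 1)) :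
    ∃ p : G.Walk (f 0) (f t), IsInducedPath p ∧ p.length = t ∧ ∀ m ≤ t, p.getVert m = f m := by
  obtain ⟨p, hl, hp⟩ := walk_of_seq (G := G) f t
    fun m hm => (hadj m (m + 1) (by omega) (by omega)).mpr rfl
  refine ⟨p, ⟨?_, ?_⟩, hl, hp⟩
  · rw [← Walk.IsPath.getVert_injOn_iff]
    intro i hi j hj hij
    simp only [Set.mem_ofPred_eq, hl] at hi hj
    rw [hp i hi, hp j hj] at hij
    rcases lt_trichotomy i j with hlt | rfl | hlt
    · exact absurd hij (hne i j hlt hj)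
    · rfl
    · exact absurd hij.symm (hne j i hlt hi)
  · rw [Walk.isChordless_iff_forall_mem_edges]
    intro x y hx hy hxy
    obtain ⟨i, hi, rfl⟩ := (support_eq_of_getVert hl hp x).mp hx
    obtain ⟨j, hj, rfl⟩ := (support_eq_of_getVert hl hp y).mp hy
    rw [Walk.mk_mem_edges_iff_exists]
    rcases lt_trichotomy i j with hlt | rfl | hlt
    · obtain rfl := (hadj i j hlt hj).mp hxy
      exact ⟨i, by omega, by rw [hp i hi, hp _ hj]⟩
    · exact absurd hxy G.irrefl
    · obtain rfl := (hadj j i hlt hi).mp hxy.symm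
      exact ⟨j, by omega, by rw [hp j hj, hp _ hi, Sym2.eq_swap]⟩

theorem _root_.IsInducedPath.getVert_ne {x y : V} {p : G.Walk x y} (hp : IsInducedPath p) {i j : ℕ}
    (hij : i < j) (hj : j ≤ p.length) : p.getVert i ≠ p.getVert j := fun h => by
  have := hp.1.getVert_injOn (show i ≤ p.length by omega) (show j ≤ p.length from hj) h
  omega

theorem _root_.IsInducedPath.adj_getVert_iff {x y : V} {p : G.Walk x y}
    (hp : IsInducedPath p) {i j : ℕ} (hij : i < j) (hj : j ≤ p.length) :
    G.Adj (p.getVert i) (p.getVert j) ↔ j = i + 1 := by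
  constructor
  · intro h
    have := hp.2.mem_edges (p.getVert_mem_support i) (p.getVert_mem_support j) h
    obtain ⟨m, hm, he⟩ := (Walk.mk_mem_edges_iff_exists p).mp this
    rw [Sym2.eq_iff] at he
    have inj := hp.1.getVert_injOn
    rcases he with ⟨h₁, h₂⟩ | ⟨h₁, h₂⟩
    · have e₁ := inj (show m ≤ p.length by omega) (show i ≤ p.length by omega) h₁
      have e₂ := inj (show m + 1 ≤ p.length by omega) (show j ≤ p.length by omega) h₂
      omega
    · have e₁ := inj (show m ≤ p.length by omega) (show j ≤ p.length by omega) h₁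
      have e₂ := inj (show m + 1 ≤ p.length by omega) (show i ≤ p.length by omega) h₂
      omega
  · rintro rfl
    exact p.adj_getVert_succ (by omega)

theorem _root_.IsHole.exists_isCyc {W : Set V} (hW : IsHole G W) :
    ∃ (w : ℤ → V) (n : ℤ), IsCyc G w n ∧ Set.range w = W := by
  obtain ⟨u, c, hc, hch, hlen, rfl⟩ := hW
  have inj := hc.getVert_injOn'
  have hL : c.getVert c.length = c.getVert 0 := by simp
  have ne : ∀ i j : ℤ, 0 ≤ i → i < j → j < c.length → c.getVert i.toNat ≠ c.getVert j.toNat := by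
    intro i j hi hij hj h
    have := inj (show i.toNat ≤ c.length - 1 by omega) (show j.toNat ≤ c.length - 1 by omega) h
    omega
  refine ⟨fun i => c.getVert (i % (c.length : ℤ)).toNat, c.length,
    IsCyc.of_window (fun i => c.getVert i.toNat) (by omega) ne ?_, ?_⟩
  · intro i j hi hij hj
    constructor
    · intro h
      have := hch.mem_edges (c.getVert_mem_support _) (c.getVert_mem_support _) h
      obtain ⟨m, hm, he⟩ := (Walk.mk_mem_edges_iff_exists c).mp this
      have inj' : ∀ a b : ℕ, a < c.length → b < c.length → c.getVert a = c.getVert b → a = b :=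
        fun a b ha hb hab => inj (show a ≤ c.length - 1 by omega)
          (show b ≤ c.length - 1 by omega) hab
      have hm' : ∃ m' < c.length, c.getVert (m + 1) = c.getVert m' ∧
          (m' = m + 1 ∨ m' = 0 ∧ m + 1 = c.length) := by
        by_cases hm' : m + 1 = c.length
        · exact ⟨0, by omega, by rw [hm', hL], Or.inr ⟨rfl, hm'⟩⟩
        · exact ⟨m + 1, by omega, rfl, Or.inl rfl⟩
      obtain ⟨m', hm'₁, hm'₂, hm'₃⟩ := hm'
      rw [hm'₂, Sym2.eq_iff] at he
      rcases he with ⟨h₁, h₂⟩ | ⟨h₁, h₂⟩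
      · have e₁ := inj' _ _ hm (by omega) h₁
        have e₂ := inj' _ _ hm'₁ (by omega) h₂
        omega
      · have e₁ := inj' _ _ hm (by omega) h₁
        have e₂ := inj' _ _ hm'₁ (by omega) h₂
        omega
    · rintro (rfl | ⟨rfl, rfl⟩)
      · have := c.adj_getVert_succ (i := i.toNat) (by omega)
        rwa [show i.toNat + 1 = (i + 1).toNat by omega] at this
      · have := c.adj_getVert_succ (i := c.length - 1) (by omega)
        rw [show c.length - 1 + 1 = c.length by omega, hL] at this
        rw [show ((c.length : ℤ) - 1).toNat = c.length - 1 by omega]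
        exact this.symm
  · ext z
    simp only [Set.mem_range, Set.mem_ofPred_eq, Walk.mem_support_iff_exists_getVert]
    constructor
    · rintro ⟨i, rfl⟩
      have := Int.emod_lt_of_pos i (show (0 : ℤ) < c.length by omega)
      exact ⟨_, rfl, by omega⟩
    · rintro ⟨m, rfl, hm⟩
      rcases hm.lt_or_eq with hm | rfl
      · refine ⟨m, ?_⟩
        rw [Int.emod_eq_of_lt (by omega) (by omega)]
        simp
      · exact ⟨0, by simp⟩

theorem IsCyc.isHole {w : ℤ → V} {n : ℤ} (h : IsCyc G w n) : IsHole G (Set.range w) := by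
  have hn := h.four_le
  obtain ⟨p, hp, hl, hg⟩ := IsInducedPath.of_seq (G := G) (fun m : ℕ => w m) (n - 2).toNat
    (fun i j hij hj => by rw [Ne, h.eq_iff (by omega) (by omega)]; omega)
    (fun i j hij hj => by rw [h.adj_iff (by omega) (by omega)]; omega)
  have e : ((n - 2).toNat : ℤ) = n - 2 := by omega
  have a₁ : G.Adj (w (n - 2 : ℤ)) (w (n - 1)) := (h.adj_iff (by omega) (by omega)).mpr (by omega)
  have a₂ : G.Adj (w (n - 1)) (w 0) := (h.adj_iff (by omega) (by omega)).mpr (by omega)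
  -- The hole is closed up through its last vertex `w (n - 1)`.
  obtain ⟨q, hq, hql, hqg⟩ : ∃ q : G.Walk (w 0) (w (n - 1)), q.IsPath ∧ q.length = (n - 1).toNat ∧
      ∀ m ≤ (n - 1).toNat, q.getVert m = w m := by
    obtain ⟨q, hql, hqg⟩ := walk_of_seq (G := G) (fun m : ℕ => w m) (n - 1).toNat
      fun m hm => by simpa using h.adj_succ m
    have hw : w ((n - 1).toNat : ℤ) = w (n - 1) := by congr 1; omega
    refine ⟨q.copy (by simp) hw, ?_, by simpa using hql, fun m hm => by simpa using hqg m hm⟩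
    rw [Walk.isPath_copy, ← Walk.IsPath.getVert_injOn_iff]
    intro i hi j hj hij
    simp only [Set.mem_ofPred_eq, hql] at hi hj
    rw [hqg i hi, hqg j hj, h.eq_iff (by omega) (by omega)] at hij
    omega
  have hedge : ∀ m : ℕ, m < (n - 1).toNat → s(w m, w (m + 1)) ∈ q.edges := by
    intro m hm
    rw [Walk.mk_mem_edges_iff_exists]
    exact ⟨m, by omega, by rw [hqg m (by omega), hqg (m + 1) (by omega)]; simp⟩
  have hsup := support_eq_of_getVert (f := fun m : ℕ => w m) hql hqg
  have hmem : ∀ i : ℤ, 0 ≤ i → i < n → w i ∈ q.support := fun i hi hin =>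
    (hsup _).mpr ⟨i.toNat, by omega, by congr 1; omega⟩
  refine ⟨w (n - 1), .cons a₂ q, ?_, ?_, ?_, ?_⟩
  · rw [Walk.cons_isCycle_iff]
    refine ⟨hq, fun he => ?_⟩
    obtain ⟨m, hm, he⟩ := (Walk.mk_mem_edges_iff_exists q).mp he
    rw [hqg m (by omega), hqg (m + 1) (by omega), Sym2.eq_iff, h.eq_iff (by omega) (by omega),
      h.eq_iff (by omega) (by omega), h.eq_iff (by omega) (by omega),
      h.eq_iff (by omega) (by omega)] at he
    omega
  · rw [Walk.isChordless_iff_forall_mem_edges]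
    have hs : ∀ z ∈ (Walk.cons a₂ q).support, ∃ i : ℕ, i ≤ (n - 1).toNat ∧ w i = z := by
      intro z hz
      rw [Walk.support_cons, List.mem_cons] at hz
      rcases hz with rfl | hz
      · exact ⟨(n - 1).toNat, le_rfl, by congr 1; omega⟩
      · exact (hsup z).mp hz
    have main : ∀ i j : ℕ, i < j → j ≤ (n - 1).toNat → G.Adj (w i) (w j) →
        s(w i, w j) ∈ (Walk.cons a₂ q).edges := by
      intro i j hij hj hadj
      rw [h.adj_iff (by omega) (by omega)] at hadj
      rw [Walk.edges_cons, List.mem_cons]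
      rcases (show (j : ℤ) = i + 1 ∨ i = 0 ∧ (j : ℤ) = n - 1 by omega) with e | ⟨rfl, e⟩
      · right
        rw [e]
        exact hedge i (by omega)
      · left
        rw [e, Sym2.eq_swap]
        simp
    intro x y hx hy hxy
    obtain ⟨i, hi, rfl⟩ := hs x hx
    obtain ⟨j, hj, rfl⟩ := hs y hy
    rcases lt_trichotomy i j with hlt | rfl | hlt
    · exact main i j hlt hj hxy
    · exact absurd hxy G.irrefl
    · rw [Sym2.eq_swap]
      exact main j i hlt hi hxy.symm
  · rw [Walk.length_cons, hql]
    omega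
  · ext z
    simp only [Set.mem_ofPred_eq, Walk.support_cons, List.mem_cons, Set.mem_range]
    constructor
    · rintro (rfl | hz)
      · exact ⟨_, rfl⟩
      · obtain ⟨m, -, hm⟩ := (hsup z).mp hz
        exact ⟨m, hm⟩
    · rintro ⟨i, rfl⟩
      obtain ⟨j, hj₁, hj₂, hj⟩ := h.exists_window 0 i
      exact Or.inr (hj ▸ hmem j hj₁ (by omega))

theorem IsCyc.ncard_range {w : ℤ → V} {n : ℤ} (h : IsCyc G w n) :
    (Set.range w).ncard = n.toNat := by
  have hn := h.four_le
  have : Set.range w = w '' (Finset.Ico 0 n : Set ℤ) := by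
    ext z
    constructor
    · rintro ⟨i, rfl⟩
      obtain ⟨j, hj₁, hj₂, hj⟩ := h.exists_window 0 i
      exact ⟨j, by simp; omega, hj⟩
    · rintro ⟨i, -, rfl⟩
      exact ⟨i, rfl⟩
  rw [this, Set.InjOn.ncard_image, Set.ncard_coe_finset]
  · simp
  · intro i hi j hj hij
    simp only [Finset.coe_Ico, Set.mem_Ico] at hi hj
    rw [h.eq_iff (by omega) (by omega)] at hij
    omega

theorem IsCyc.isLongSector {w : ℤ → V} {n : ℤ} (h : IsCyc G w n) {v : V} {i j : ℤ}
    (h₁ : i + 2 ≤ j) (h₂ : j + 2 ≤ i + n) (hi : G.Adj v (w i)) (hj : G.Adj v (w j))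
    (hij : ∀ m, i < m → m < j → ¬ G.Adj v (w m)) :
    IsLongSector G (Set.range w) v (w '' Set.Icc i j) := by
  obtain ⟨p, hp, hl, hg⟩ := IsInducedPath.of_seq (G := G) (fun m : ℕ => w (i + m)) (j - i).toNat
    (fun a b hab hb => by rw [Ne, h.eq_iff (by omega) (by omega)]; omega)
    (fun a b hab hb => by rw [h.adj_iff (by omega) (by omega)]; omega)
  have hsup := support_eq_of_getVert (f := fun m : ℕ => w (i + m)) hl hg
  have e₀ : i + ((0 : ℕ) : ℤ) = i := by simp
  have e₁ : i + ((j - i).toNat : ℤ) = j := by omega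
  have hend : ∀ m : ℕ, m ≤ (j - i).toNat → w (i + m) ≠ w (i + ((0 : ℕ) : ℤ)) →
      w (i + m) ≠ w (i + ((j - i).toNat : ℤ)) → i < i + m ∧ i + m < j := by
    intro m hm h₁ h₂
    constructor
    · by_contra hc
      exact h₁ (by congr 1; omega)
    · by_contra hc
      exact h₂ (by congr 1; omega)
  refine ⟨?_, _, _, p, hp, ?_, by simpa using hi, by simpa only [e₁] using hj, ?_, ?_⟩
  · rintro _ ⟨m, -, rfl⟩
    exact ⟨m, rfl⟩
  · ext z
    rw [Set.mem_ofPred_eq, hsup]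
    constructor
    · rintro ⟨m, hm, rfl⟩
      exact ⟨i + m, ⟨by omega, by omega⟩, rfl⟩
    · rintro ⟨m, ⟨hm₁, hm₂⟩, rfl⟩
      exact ⟨(m - i).toNat, by omega, by congr 1; omega⟩
  · refine ⟨w (i + 1), (hsup _).mpr ⟨1, by omega, by simp⟩, ?_, ?_⟩
    · rw [Ne, h.eq_iff (by omega) (by omega)]
      omega
    · rw [Ne, h.eq_iff (by omega) (by omega)]
      omega
  · rintro z ⟨hz, hz₁, hz₂⟩
    obtain ⟨m, hm, rfl⟩ := (hsup z).mp hz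
    obtain ⟨h₁, h₂⟩ := hend m hm hz₁ hz₂
    exact hij _ h₁ h₂

namespace IsCyc

variable {w : ℤ → V} {n : ℤ}

theorem exists_prev (h : IsCyc G w n) (Q : V → Prop) (hQ : ∃ m, Q (w m)) (k : ℤ) :
    ∃ i, i < k ∧ k - n ≤ i ∧ Q (w i) ∧ ∀ m, i < m → m < k → ¬ Q (w m) := by
  have hn := h.four_le
  obtain ⟨m, hm⟩ := hQ
  obtain ⟨j, hj₁, hj₂, hj⟩ := h.exists_window (k - n) m
  obtain ⟨i, ⟨hi₁, hi₂⟩, hmax⟩ := Int.exists_greatest_of_bdd (P := fun z => z < k ∧ Q (w z))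
    ⟨k, fun z hz => hz.1.le⟩ ⟨j, by omega, hj ▸ hm⟩
  refine ⟨i, hi₁, ?_, hi₂, fun m h₁ h₂ h₃ => ?_⟩
  · have := hmax j ⟨by omega, hj ▸ hm⟩
    omega
  · have := hmax m ⟨h₂, h₃⟩
    omega

theorem exists_next (h : IsCyc G w n) (Q : V → Prop) (hQ : ∃ m, Q (w m)) (k : ℤ) :
    ∃ i, k < i ∧ i ≤ k + n ∧ Q (w i) ∧ ∀ m, k < m → m < i → ¬ Q (w m) := by
  obtain ⟨m, hm⟩ := hQ
  obtain ⟨i, h₁, h₂, h₃, h₄⟩ := h.reflect.exists_prev Q ⟨-m, by simpa using hm⟩ (-k)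
  exact ⟨-i, by omega, by omega, h₃, fun m m₁ m₂ => by
    simpa using h₄ (-m) (by omega) (by omega)⟩

theorem adj_imp (h : IsCyc G w n) {a b : ℤ} (hab : G.Adj (w a) (w b)) :
    w b = w (a + 1) ∨ w b = w (a - 1) := by
  rw [h.adj_iff_dvd] at hab
  rw [h.eq_iff_dvd, h.eq_iff_dvd, ← dvd_neg, ← dvd_neg (b := a - 1 - b)]
  rwa [show -(a + 1 - b) = b - a - 1 by ring, show -(a - 1 - b) = b - a + 1 by ring]

end IsCyc

/-- The arc from index `i` to index `j` is a sector of the hole with respect to `v`: its ends are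
consecutive neighbours of `v`. -/
structure IsSector (G : SimpleGraph V) (w : ℤ → V) (v : V) (i j : ℤ) : Prop where
  lt : i < j
  left : G.Adj v (w i)
  right : G.Adj v (w j)
  not_adj : ∀ m, i < m → m < j → ¬ G.Adj v (w m)

theorem IsSector.reflect {w : ℤ → V} {v : V} {i j : ℤ} (h : IsSector G w v i j) :
    IsSector G (fun i => w (-i)) v (-j) (-i) where
  lt := by have := h.lt; omega
  left := by simpa using h.right
  right := by simpa using h.left
  not_adj m h₁ h₂ := h.not_adj (-m) (by omega) (by omega)

/-- A long sector in the sense of induced paths is an arc between consecutive neighbours of the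
hub, and it is determined by any of its interior vertices. -/
theorem IsCyc.exists_of_isLongSector {w : ℤ → V} {n : ℤ} (h : IsCyc G w n) {v : V} {S : Set V}
    (hS : IsLongSector G (Set.range w) v S) :
    ∃ k, ¬ G.Adj v (w k) ∧ ∀ k', w k' = w k → ∀ i j, i < k' → k' < j → IsSector G w v i j →
      S = w '' Set.Icc i j := by
  obtain ⟨hSW, x, y, p, hp, rfl, hvx, hvy, ⟨z, hz⟩, hint⟩ := hS
  obtain ⟨k, hk⟩ := hSW hz.1
  refine ⟨k, fun hc => hint z hz (hk ▸ hc), fun k' hk' i j hik hkj hs => ?_⟩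
  rw [hk] at hk'
  have hn := h.four_le
  have hi := hs.left
  have hj := hs.right
  have hij := hs.not_adj
  obtain ⟨m₀, hm₀, hm₀l⟩ := Walk.mem_support_iff_exists_getVert.mp hz.1
  have hm₀pos : 0 < m₀ := by
    rcases Nat.eq_zero_or_pos m₀ with rfl | h0
    · exact absurd (by simpa using hm₀.symm) hz.2.1
    · exact h0
  have hm₀lt : m₀ < p.length := by
    rcases hm₀l.lt_or_eq with h0 | rfl
    · exact h0
    · exact absurd (by simpa using hm₀.symm) hz.2.2
  have hxy : x ≠ y := by
    have := hp.getVert_ne (i := 0) (j := p.length) (by omega) le_rfl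
    simpa using this
  have hxy' : ¬ G.Adj x y := by
    have := hp.adj_getVert_iff (i := 0) (j := p.length) (by omega) le_rfl
    simp only [Walk.getVert_zero, Walk.getVert_length] at this
    rw [this]
    omega
  have hpi : ∀ m, 0 < m → m < p.length → p.getVert m ∈ pathInterior p := by
    intro m h₁ h₂
    refine ⟨p.getVert_mem_support m, fun he => ?_, fun he => ?_⟩
    · exact hp.getVert_ne h₁ h₂.le (by simpa using he.symm)
    · exact hp.getVert_ne h₂ le_rfl (by simpa using he)
  -- A neighbour on the hole of an index inside the sector stays in the closed sector.
  have step : ∀ a, i < a → a < j → ∀ t ∈ Set.range w, G.Adj (w a) t →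
      ∃ b, i ≤ b ∧ b ≤ j ∧ w b = t := by
    rintro a ha₁ ha₂ _ ⟨b, rfl⟩ hab
    rcases h.adj_imp hab with e | e
    · exact ⟨a + 1, by omega, by omega, e.symm⟩
    · exact ⟨a - 1, by omega, by omega, e.symm⟩
  have hin : ∀ m, 0 < m → m < p.length → ∃ b, i < b ∧ b < j ∧ w b = p.getVert m := by
    intro m h₁ h₂
    have hl : Linked G (pathInterior p) (p.getVert m₀) (p.getVert m) := by
      rcases le_total m₀ m with hle | hle
      · exact linked_of_seq p.getVert hle (fun r _ hr => p.adj_getVert_succ (by omega))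
          fun r hr hr' => hpi r (by omega) (by omega)
      · exact (linked_of_seq p.getVert hle (fun r _ hr => p.adj_getVert_succ (by omega))
          fun r hr hr' => hpi r (by omega) (by omega)).symm
    refine hl.induct (Q := fun t => ∃ b, i < b ∧ b < j ∧ w b = t) ?_
      ⟨k', hik, hkj, by rw [hk', hm₀]⟩
    rintro s hs t ht hst ⟨a, ha₁, ha₂, rfl⟩
    obtain ⟨b, hb₁, hb₂, rfl⟩ := step a ha₁ ha₂ t (hSW ht.1) hst
    refine ⟨b, lt_of_le_of_ne hb₁ ?_, lt_of_le_of_ne hb₂ ?_, rfl⟩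
    · rintro rfl
      exact hint _ ht hi
    · rintro rfl
      exact hint _ ht hj
  have hends : ∀ t ∈ p.support, ∀ m, 0 < m → m < p.length → G.Adj (p.getVert m) t → G.Adj v t →
      t = w i ∨ t = w j := by
    intro t ht m h₁ h₂ hadj hvt
    obtain ⟨a, ha₁, ha₂, ha⟩ := hin m h₁ h₂
    obtain ⟨b, hb₁, hb₂, rfl⟩ := step a ha₁ ha₂ t (hSW ht) (by rw [ha]; exact hadj)
    by_contra hc
    rw [not_or] at hc
    exact hij b (lt_of_le_of_ne hb₁ fun e => hc.1 (by rw [e]))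
      (lt_of_le_of_ne hb₂ fun e => hc.2 (by rw [e])) hvt
  have hx : x = w i ∨ x = w j := hends x p.start_mem_support 1 one_pos (by omega)
    (by simpa using (p.adj_getVert_succ (i := 0) (by omega)).symm) hvx
  have hy : y = w i ∨ y = w j := hends y p.end_mem_support (p.length - 1) (by omega) (by omega)
    (by
      have := p.adj_getVert_succ (i := p.length - 1) (by omega)
      rwa [show p.length - 1 + 1 = p.length by omega, Walk.getVert_length] at this) hvy
  have hsub : ∀ t ∈ p.support, ∃ b, i ≤ b ∧ b ≤ j ∧ w b = t := by
    intro t ht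
    by_cases h₁ : t = x
    · rcases hx with e | e
      · exact ⟨i, le_rfl, by omega, by rw [h₁, e]⟩
      · exact ⟨j, by omega, le_rfl, by rw [h₁, e]⟩
    by_cases h₂ : t = y
    · rcases hy with e | e
      · exact ⟨i, le_rfl, by omega, by rw [h₂, e]⟩
      · exact ⟨j, by omega, le_rfl, by rw [h₂, e]⟩
    obtain ⟨m, rfl, hm⟩ := Walk.mem_support_iff_exists_getVert.mp ht
    obtain ⟨b, hb₁, hb₂, hb⟩ := hin m
      (Nat.pos_of_ne_zero fun e => h₁ (by simp [e]))
      (lt_of_le_of_ne hm fun e => h₂ (by simp [e]))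
    exact ⟨b, hb₁.le, hb₂.le, hb⟩
  have hlij : Linked G {t | t ∈ p.support} (w i) (w j) := by
    have hl : Linked G {t | t ∈ p.support} x y := ⟨p, fun t ht => ht⟩
    rcases hx with rfl | rfl <;> rcases hy with rfl | rfl
    · exact absurd rfl hxy
    · exact hl
    · exact hl.symm
    · exact absurd rfl hxy
  have hne : w i ≠ w j := by
    intro e
    rcases hx with rfl | rfl <;> rcases hy with rfl | rfl <;> simp_all
  have hnadj : ¬ G.Adj (w i) (w j) := by
    intro e
    rcases hx with rfl | rfl <;> rcases hy with rfl | rfl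
    · exact hxy rfl
    · exact hxy' e
    · exact hxy' e.symm
    · exact hxy rfl
  have hjn : j ≤ i + n := by
    by_contra! hc
    obtain ⟨b, hb₁, hb₂, hb⟩ := h.exists_window (i + 1) i
    exact hij b (by omega) (by omega) (hb ▸ hi)
  rw [Ne, h.eq_iff (by omega) (by omega)] at hne
  rw [h.adj_iff (by omega) (by omega)] at hnadj
  apply Set.Subset.antisymm
  · intro t ht
    obtain ⟨b, hb₁, hb₂, hb⟩ := hsub t ht
    exact ⟨b, ⟨hb₁, hb₂⟩, hb⟩
  · rintro _ ⟨m, ⟨hm₁, hm₂⟩, rfl⟩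
    by_contra hm
    have him : i < m := lt_of_le_of_ne hm₁ fun e => hm (e ▸ hlij.left_mem)
    -- The path would have to jump over the missing vertex `w m`.
    obtain ⟨b, hb₁, hb₂, hb⟩ := hlij.induct (Q := fun t => ∃ b, i ≤ b ∧ b < m ∧ w b = t) (by
      rintro s hs t ht hst ⟨a, ha₁, ha₂, rfl⟩
      obtain ⟨b, hb₁, hb₂, rfl⟩ := hsub t ht
      have hbm : b ≠ m := fun e => hm (e ▸ ht)
      rw [h.adj_iff (by omega) (by omega)] at hst
      exact ⟨b, hb₁, by omega, rfl⟩) ⟨i, le_rfl, him, rfl⟩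
    rw [h.eq_iff (by omega) (by omega)] at hb
    omega

/-- The data of an optimal wheel with hub `v` in a graph of the class considered, its rim being
parametrised by `w`. Two long sectors are recorded as two non-neighbours of `v` on the rim that are
separated by neighbours of `v`. -/
structure Wheel (G : SimpleGraph V) (w : ℤ → V) (n : ℤ) (v : V) : Prop where
  cyc : IsCyc G w n
  ne_hub : ∀ i, w i ≠ v
  gaps : ∃ i k j k', i < k ∧ k < j ∧ j < k' ∧ k' < i + n ∧ G.Adj v (w i) ∧ ¬ G.Adj v (w k) ∧
    G.Adj v (w j) ∧ ¬ G.Adj v (w k')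
  third : ∀ i j, ∃ m, G.Adj v (w m) ∧ w m ≠ w i ∧ w m ≠ w j
  theta : ¬ ContainsTheta G
  pyramid : ¬ ContainsPyramid G
  prism : ¬ ContainsPrism G
  pinched : ¬ ContainsPinchedPrism G
  cube : ¬ cube.IsIndContained G
  optimal : ∀ W' : Set V, IsWheel G W' v →
    (G.neighborSet v ∩ Set.range w).ncard ≤ (G.neighborSet v ∩ W').ncard

theorem Wheel.reflect {w : ℤ → V} {n : ℤ} {v : V} (h : Wheel G w n v) :
    Wheel G (fun i => w (-i)) n v where
  cyc := h.cyc.reflect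
  ne_hub i := h.ne_hub _
  gaps := by
    obtain ⟨i, k, j, k', h₁, h₂, h₃, h₄, a₁, a₂, a₃, a₄⟩ := h.gaps
    exact ⟨-j, -k, -i, -k' + n, by omega, by omega, by omega, by omega, by simpa using a₃,
      by simpa using a₂, by simpa using a₁, by
        rwa [show -(-k' + n) = k' - n by ring, h.cyc.sub_period]⟩
  third i j := by
    obtain ⟨m, h₁, h₂, h₃⟩ := h.third (-i) (-j)
    exact ⟨-m, by simpa using h₁, by simpa using h₂, by simpa using h₃⟩
  theta := h.theta
  pyramid := h.pyramid
  prism := h.prism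
  pinched := h.pinched
  cube := h.cube
  optimal := by
    rw [IsCyc.range_reflect]
    exact h.optimal

theorem Wheel.of_isOptimalWheel [Finite V] (hG : InClassCStar G) {W : Set V} {v : V}
    (hW : IsOptimalWheel G W v) : ∃ (w : ℤ → V) (n : ℤ), Wheel G w n v ∧ Set.range w = W := by
  obtain ⟨⟨hθ, hpy, hgp⟩, hcube⟩ := hG
  obtain ⟨⟨hole, -, hvW, hthree, S, T, hST, hS, hT⟩, hopt⟩ := hW
  obtain ⟨w, n, h, rfl⟩ := hole.exists_isCyc
  refine ⟨w, n, ⟨h, fun i hi => hvW ⟨i, hi⟩, ?_, ?_, hθ, hpy, fun hc => hgp (.inl hc),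
    fun hc => hgp (.inr hc), hcube, hopt⟩, rfl⟩
  · obtain ⟨a, b, c, ha, -⟩ := (Set.two_lt_ncard_iff (Set.toFinite _)).mp hthree
    obtain ⟨ha₁, m₀, rfl⟩ := ha
    have hex : ∃ m, G.Adj v (w m) := ⟨m₀, ha₁⟩
    obtain ⟨k, hk, hkS⟩ := h.exists_of_isLongSector hS
    obtain ⟨i, i₁, -, i₃, i₄⟩ := h.exists_prev (G.Adj v) hex k
    obtain ⟨j, j₁, -, j₃, j₄⟩ := h.exists_next (G.Adj v) hex k
    have hij : ∀ m, i < m → m < j → ¬ G.Adj v (w m) := by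
      intro m h₁ h₂
      rcases lt_trichotomy m k with h₃ | rfl | h₃
      · exact i₄ m h₁ h₃
      · exact hk
      · exact j₄ m h₃ h₂
    have hSe := hkS k rfl i j i₁ j₁ ⟨by omega, i₃, j₃, hij⟩
    obtain ⟨k₀, hk₀, hkT⟩ := h.exists_of_isLongSector hT
    obtain ⟨k', k₁, k₂, k₃⟩ := h.exists_window i k₀
    have hk' : ¬ G.Adj v (w k') := k₃ ▸ hk₀
    have hki : k' ≠ i := fun e => hk' (e ▸ i₃)
    have hkj : k' ≠ j := fun e => hk' (e ▸ j₃)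
    refine ⟨i, k, j, k', i₁, j₁, ?_, k₂, i₃, hk, j₃, hk'⟩
    by_contra hc
    exact hST (hSe.trans (hkT k' k₃ i j (by omega) (by omega) ⟨by omega, i₃, j₃, hij⟩).symm)
  · obtain ⟨a, b, c, ⟨ha, p, rfl⟩, ⟨hb, q, rfl⟩, ⟨hc, r, rfl⟩, hab, hac, hbc⟩ :=
      (Set.two_lt_ncard_iff (Set.toFinite _)).mp hthree
    intro i j
    by_contra! hcon
    have h₁ := hcon p ha
    have h₂ := hcon q hb
    have h₃ := hcon r hc
    by_cases e₁ : w p = w i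
    · have e₂ := h₂ fun e => hab (e₁.trans e.symm)
      have e₃ := h₃ fun e => hac (e₁.trans e.symm)
      exact hbc (e₂.trans e₃.symm)
    · have e₁' := h₁ e₁
      by_cases e₂ : w q = w i
      · have e₃ := h₃ fun e => hbc (e₂.trans e.symm)
        exact hac (e₁'.trans e₃.symm)
      · exact hab (e₁'.trans (h₂ e₂).symm)

variable {w : ℤ → V} {n : ℤ} {v : V}

/-! ### Connected sets away from a wheel -/

/-- Some vertex of `P` is adjacent to `x`. -/
def Att (G : SimpleGraph V) (P : Set V) (x : V) : Prop :=
  ∃ p ∈ P, G.Adj p x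

theorem Att.mono {P Q : Set V} {x : V} (h : Att G P x) (hPQ : P ⊆ Q) : Att G Q x := by
  obtain ⟨p, hp, hx⟩ := h
  exact ⟨p, hPQ hp, hx⟩

/-- `P` is a connected set of vertices, disjoint from the rim of the wheel and from the closed
neighbourhood of its hub. -/
structure Away (G : SimpleGraph V) (w : ℤ → V) (v : V) (P : Set V) : Prop where
  linked : ∀ x ∈ P, ∀ y ∈ P, Linked G P x y
  ne_rim : ∀ x ∈ P, ∀ i, w i ≠ x
  ne_hub : ∀ x ∈ P, x ≠ v
  not_adj : ∀ x ∈ P, ¬ G.Adj v x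

theorem Away.reflect {P : Set V} (h : Away G w v P) : Away G (fun i => w (-i)) v P :=
  ⟨h.linked, fun x hx _ => h.ne_rim x hx _, h.ne_hub, h.not_adj⟩

/-- All neighbours of `P` on the rim lie in one (long or short) sector. -/
def Local (G : SimpleGraph V) (w : ℤ → V) (n : ℤ) (v : V) (P : Set V) : Prop :=
  ∃ i j, IsSector G w v i j ∧ ∀ m, j < m → m < i + n → ¬ Att G P (w m)

theorem Local.reflect (h : Wheel G w n v) {P : Set V} (hP : Local G w n v P) :
    Local G (fun i => w (-i)) n v P := by
  obtain ⟨i, j, hs, hm⟩ := hP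
  refine ⟨-j, -i, hs.reflect, fun m h₁ h₂ => ?_⟩
  have := hm (-m + n) (by omega) (by omega)
  rwa [h.cyc.add_period] at this

theorem reflect_reflect (w : ℤ → V) : (fun i : ℤ => (fun i => w (-i)) (-i)) = w := by
  funext i
  simp

theorem not_local_reflect (h : Wheel G w n v) {P : Set V} (hP : ¬ Local G w n v P) :
    ¬ Local G (fun i => w (-i)) n v P := fun hc => by
  have := Local.reflect h.reflect hc
  rw [reflect_reflect] at this
  exact hP this

namespace Wheel

theorem exists_spoke (h : Wheel G w n v) : ∃ m, G.Adj v (w m) := by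
  obtain ⟨i, _, _, _, _, _, _, _, hi, _⟩ := h.gaps
  exact ⟨i, hi⟩

/-- There are at least three spokes, so a sector does not come near to closing up. -/
theorem sector_le (h : Wheel G w n v) {i j : ℤ} (hs : IsSector G w v i j) : j + 2 ≤ i + n := by
  have := hs.lt
  obtain ⟨m, m₁, m₂, m₃⟩ := h.third i (i + n - 1)
  obtain ⟨a, a₁, a₂, a₃⟩ := h.cyc.exists_window i m
  rw [← a₃] at m₁ m₂ m₃
  have : a ≠ i := fun e => m₂ (by rw [e])
  have : a ≠ i + n - 1 := fun e => m₃ (by rw [e])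
  by_contra
  exact hs.not_adj a (by omega) (by omega) m₁

theorem exists_sector_of_arc (h : Wheel G w n v) {a b : ℤ}
    (hsp : ∀ m, a < m → m < b → ¬ G.Adj v (w m)) :
    ∃ i j, IsSector G w v i j ∧ i ≤ a ∧ b ≤ j ∧ a < j := by
  obtain ⟨i, i₁, -, i₃, i₄⟩ := h.cyc.exists_prev (G.Adj v) h.exists_spoke (a + 1)
  obtain ⟨j, j₁, -, j₃, j₄⟩ := h.cyc.exists_next (G.Adj v) h.exists_spoke i
  have haj : a < j := by
    by_contra
    exact i₄ j j₁ (by omega) j₃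
  refine ⟨i, j, ⟨j₁, i₃, j₃, j₄⟩, by omega, ?_, haj⟩
  by_contra
  exact hsp j haj (by omega) j₃

/-- A set attached only to an arc without spokes in its interior is local. -/
theorem local_of_arc (h : Wheel G w n v) {P : Set V} {a b : ℤ}
    (hsp : ∀ m, a < m → m < b → ¬ G.Adj v (w m))
    (hat : ∀ m, b < m → m < a + n → ¬ Att G P (w m)) : Local G w n v P := by
  obtain ⟨i, j, hs, h₁, h₂, -⟩ := h.exists_sector_of_arc hsp
  exact ⟨i, j, hs, fun m m₁ m₂ => hat m (by omega) (by omega)⟩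

theorem exists_att_of_not_local (h : Wheel G w n v) {P : Set V} (hP : ¬ Local G w n v P) :
    ∃ m, Att G P (w m) := by
  by_contra! hc
  exact hP (h.local_of_arc (a := 0) (b := 0) (fun m h₁ h₂ => by omega) fun m _ _ => hc m)

/-- Suppose that `P` is attached to the ends of an arc of the rim but not to its interior, and that
this arc carries two spokes with a non-spoke between them. Closing up the arc through `P` gives a
hole which, if the arc misses some spoke, is a wheel with fewer spokes or lies in a theta. -/
theorem no_spoke_outside [Finite V] (h : Wheel G w n v) {P : Set V} (hP : Away G w v P)
    {a b i k j : ℤ} (hb : b + 2 ≤ a + n) (ha : Att G P (w a)) (hb' : Att G P (w b))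
    (hat : ∀ m, a < m → m < b → ¬ Att G P (w m)) (hai : a ≤ i) (hik : i < k) (hkj : k < j)
    (hjb : j ≤ b) (hi : G.Adj v (w i)) (hk : ¬ G.Adj v (w k)) (hj : G.Adj v (w j)) (m : ℤ)
    (hm₁ : b < m) (hm₂ : m < a + n) : ¬ G.Adj v (w m) := by
  intro hm
  have hn := h.cyc.four_le
  -- The spokes nearest to `k` on both sides.
  obtain ⟨i', i₁, i₂, i₃, i₄⟩ := h.cyc.exists_prev (G.Adj v) h.exists_spoke k
  obtain ⟨j', j₁, j₂, j₃, j₄⟩ := h.cyc.exists_next (G.Adj v) h.exists_spoke k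
  have hii : i ≤ i' := by
    by_contra
    exact i₄ i (by omega) hik hi
  have hjj : j' ≤ j := by
    by_contra
    exact j₄ j hkj (by omega) hj
  have hs : ∀ m, i' < m → m < j' → ¬ G.Adj v (w m) := by
    intro m h₁ h₂
    rcases lt_trichotomy m k with h₃ | rfl | h₃
    · exact i₄ m h₁ h₃
    · exact hk
    · exact j₄ m h₃ h₂
  clear i₄ j₄ hi hj i₂ j₂
  obtain ⟨pa, hpa, hpa'⟩ := ha
  obtain ⟨pb, hpb, hpb'⟩ := hb'
  have hlink : Linked G (insert (w b) (insert (w a) P)) (w b) (w a) :=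
    ((Linked.of_adj (by simp) (by simp [hpb]) hpb'.symm).trans
      ((hP.linked pb hpb pa hpa).mono (by intro x hx; simp [hx]))).trans
      (.of_adj (by simp [hpa]) (by simp) hpa')
  by_cases hl : ∃ l, a ≤ l ∧ l ≤ b ∧ l ≠ i' ∧ l ≠ j' ∧ G.Adj v (w l)
  · obtain ⟨l, l₁, l₂, l₃, l₄, hl⟩ := hl
    have l₅ : l < i' ∨ j' < l := by
      by_contra
      exact hs l (by omega) (by omega) hl
    obtain ⟨p, hp, hpP⟩ := hlink.exists_isInducedPath
    have hp0 : p.getVert 0 = w b := by simp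
    have hpL : p.getVert p.length = w a := by simp
    have hL : 2 ≤ p.length := by
      by_contra hc
      have hab : w b ≠ w a := by
        rw [Ne, h.cyc.eq_iff (by omega) (by omega)]; omega
      have hab' : ¬ G.Adj (w b) (w a) := by
        rw [h.cyc.adj_iff (by omega) (by omega)]; omega
      rcases (show p.length = 0 ∨ p.length = 1 by omega) with e | e
      · exact hab (Walk.eq_of_length_eq_zero e)
      · exact hab' (Walk.adj_of_length_eq_one e)
    have hpint : ∀ t : ℕ, 0 < t → t < p.length → p.getVert t ∈ P := by
      intro t h₁ h₂
      have := hpP _ (p.getVert_mem_support t)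
      rcases this with e | e | e
      · exact absurd (hp0.trans e.symm) (IsInducedPath.getVert_ne hp h₁ h₂.le)
      · exact absurd (e.trans hpL.symm) (IsInducedPath.getVert_ne hp h₂ le_rfl)
      · exact e
    -- The new rim: first the arc from `a` to `b`, then the path through `P` back to `a`.
    set f : ℤ → V := fun m => if m ≤ b - a then w (a + m) else p.getVert (m - (b - a)).toNat
      with hf
    set N : ℤ := b - a + p.length with hN
    have f₁ : ∀ m, m ≤ b - a → f m = w (a + m) := fun m hm => if_pos hm
    have f₂ : ∀ m, b - a < m → f m = p.getVert (m - (b - a)).toNat := fun m hm =>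
      if_neg (by omega)
    have f₃ : ∀ m, b - a < m → m < N → f m ∈ P := fun m h₁ h₂ => by
      rw [f₂ m h₁]
      exact hpint _ (by omega) (by omega)
    have hcyc : IsCyc G (fun i => f (i % N)) N := by
      refine IsCyc.of_window f (by omega) ?_ ?_
      · intro x y hx hxy hy
        rcases le_or_gt y (b - a) with c | c
        · rw [f₁ x (by omega), f₁ y c, Ne, h.cyc.eq_iff (by omega) (by omega)]
          omega
        · rcases le_or_gt x (b - a) with d | d
          · rw [f₁ x d]
            exact hP.ne_rim _ (f₃ y c hy) _
          · rw [f₂ x d, f₂ y c]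
            exact IsInducedPath.getVert_ne hp (by omega) (by omega)
      · intro x y hx hxy hy
        rcases le_or_gt y (b - a) with c | c
        · rw [f₁ x (by omega), f₁ y c, h.cyc.adj_iff (by omega) (by omega)]
          omega
        · rcases le_or_gt x (b - a) with d | d
          · rcases (show x = 0 ∨ (0 < x ∧ x < b - a) ∨ x = b - a by omega) with e | e | e
            · have e₀ : f x = p.getVert p.length := by rw [f₁ x d, e, add_zero, hpL]
              rw [e₀, f₂ y c, G.adj_comm,
                IsInducedPath.adj_getVert_iff hp (by omega) le_rfl]
              omega
            · rw [f₁ x d]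
              have h₁ : ¬ G.Adj (w (a + x)) (f y) := fun hc =>
                hat (a + x) (by omega) (by omega) ⟨f y, f₃ y c hy, hc.symm⟩
              simp only [h₁, false_iff]
              omega
            · have e₀ : f x = p.getVert 0 := by
                rw [f₁ x d, e, show a + (b - a) = b by ring, hp0]
              rw [e₀, f₂ y c,
                IsInducedPath.adj_getVert_iff hp (by omega) (by omega)]
              omega
          · rw [f₂ x d, f₂ y c, IsInducedPath.adj_getVert_iff hp (by omega) (by omega)]
            omega
    set w' : ℤ → V := fun i => f (i % N) with hw'
    have w₁ : ∀ m, 0 ≤ m → m ≤ b - a → w' m = w (a + m) := fun m h₁ h₂ => by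
      simp only [hw']
      rw [Int.emod_eq_of_lt h₁ (by omega), f₁ m h₂]
    have w₂ : ∀ m, b - a < m → m < N → w' m ∈ P := fun m h₁ h₂ => by
      simp only [hw']
      rw [Int.emod_eq_of_lt (by omega) h₂]
      exact f₃ m h₁ h₂
    have w₃ : ∀ m, a ≤ m → m ≤ b → w' (m - a) = w m := fun m h₁ h₂ => by
      rw [w₁ _ (by omega) (by omega)]
      congr 1
      ring
    have w₄ : ∀ x, (∃ m, a ≤ m ∧ m ≤ b ∧ w' x = w m) ∨ w' x ∈ P := by
      intro x
      obtain ⟨y, y₁, y₂, y₃⟩ := hcyc.exists_window 0 x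
      rw [← y₃]
      rcases le_or_gt y (b - a) with c | c
      · exact Or.inl ⟨a + y, by omega, by omega, w₁ y y₁ c⟩
      · exact Or.inr (w₂ y c (by omega))
    have hwheel : IsWheel G (Set.range w') v := by
      refine ⟨hcyc.isHole, ?_, ?_, ?_, ?_⟩
      · rw [hcyc.ncard_range]
        omega
      · rintro ⟨x, hx⟩
        rcases w₄ x with ⟨m, -, -, e⟩ | e
        · exact h.ne_hub m (e.symm.trans hx)
        · exact hP.ne_hub _ e hx
      · rw [Nat.succ_le_iff, Set.two_lt_ncard_iff (Set.toFinite _)]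
        refine ⟨w i', w j', w l, ⟨i₃, i' - a, w₃ _ (by omega) (by omega)⟩,
          ⟨j₃, j' - a, w₃ _ (by omega) (by omega)⟩, ⟨hl, l - a, w₃ _ l₁ l₂⟩, ?_, ?_, ?_⟩ <;>
        · rw [Ne, h.cyc.eq_iff (by omega) (by omega)]
          omega
      · obtain ⟨c, c₁, c₂, c₃, c₄⟩ := h.cyc.exists_next (G.Adj v) h.exists_spoke (a - 1)
        obtain ⟨d, d₁, d₂, d₃, d₄⟩ := h.cyc.exists_prev (G.Adj v) h.exists_spoke (b + 1)
        have hci : c ≤ i' := by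
          by_contra
          exact c₄ i' (by omega) (by omega) i₃
        have hdj : j' ≤ d := by
          by_contra
          exact d₄ j' (by omega) (by omega) j₃
        refine ⟨w' '' Set.Icc (i' - a) (j' - a), w' '' Set.Icc (d - a) (c - a + N), ?_,
          hcyc.isLongSector (by omega) (by omega) ?_ ?_ ?_,
          hcyc.isLongSector (by omega) (by omega) ?_ ?_ ?_⟩
        · intro e
          have : w' (b - a + 1) ∈ w' '' Set.Icc (i' - a) (j' - a) := by
            rw [e]
            exact ⟨_, ⟨by omega, by omega⟩, rfl⟩
          obtain ⟨x, ⟨x₁, x₂⟩, hx⟩ := this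
          rw [w₁ x (by omega) (by omega)] at hx
          exact hP.ne_rim _ (w₂ (b - a + 1) (by omega) (by omega)) _ hx
        · rwa [w₃ _ (by omega) (by omega)]
        · rwa [w₃ _ (by omega) (by omega)]
        · intro x x₁ x₂
          rw [w₁ x (by omega) (by omega)]
          exact hs _ (by omega) (by omega)
        · rwa [w₃ _ (by omega) (by omega)]
        · rwa [hcyc.add_period, w₃ _ (by omega) (by omega)]
        · intro x x₁ x₂
          rcases le_or_gt x (b - a) with y | y
          · rw [w₁ x (by omega) y]
            exact d₄ _ (by omega) (by omega)
          · rcases lt_or_ge x N with z | z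
            · exact hP.not_adj _ (w₂ x y z)
            · rw [← hcyc.sub_period, w₁ _ (by omega) (by omega)]
              exact c₄ _ (by omega) (by omega)
    have hlt : (G.neighborSet v ∩ Set.range w').ncard < (G.neighborSet v ∩ Set.range w).ncard := by
      apply Set.ncard_lt_ncard _ (Set.toFinite _)
      refine ⟨?_, fun hc => ?_⟩
      · rintro _ ⟨hx, x, rfl⟩
        rcases w₄ x with ⟨m, -, -, e⟩ | e
        · exact ⟨hx, m, e.symm⟩
        · exact absurd hx (hP.not_adj _ e)
      · obtain ⟨-, x, hx⟩ := hc ⟨hm, m, rfl⟩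
        rcases w₄ x with ⟨m', m₁, m₂, e⟩ | e
        · rw [hx, h.cyc.eq_iff (by omega) (by omega)] at e
          omega
        · exact hP.ne_rim _ e m hx.symm
    exact absurd (h.optimal _ hwheel) (not_le.mpr hlt)
  · push Not at hl
    -- The arc carries only two spokes: they are the ends of a theta, with one path
    -- through `v`.
    refine h.theta (containsTheta_of_sets (a := w i') (b := w j') (A := {v})
      (B := w '' Set.Icc (i' + 1) (j' - 1))
      (C := w '' Set.Icc (j' + 1) b ∪ P ∪ w '' Set.Icc a (i' - 1)) ?_ ?_ ?_ ?_ ?_ ?_ ?_ ?_)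
    · rw [Ne, h.cyc.eq_iff (by omega) (by omega)]
      omega
    · rw [h.cyc.adj_iff (by omega) (by omega)]
      omega
    · exact (Linked.of_adj (by simp) (by simp) i₃.symm).trans (.of_adj (by simp) (by simp) j₃)
    · refine h.cyc.linked_arc (by omega) fun m h₁ h₂ => ?_
      rcases (show m = i' ∨ m = j' ∨ (i' + 1 ≤ m ∧ m ≤ j' - 1) by omega) with rfl | rfl | e
      · simp
      · simp
      · exact Or.inr (Or.inr ⟨m, e, rfl⟩)
    · refine (((h.cyc.linked_arc (i := j') (j := b) (by omega) ?_).trans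
        (hlink.mono ?_)).trans (h.cyc.linked_arc (i := a) (j := i') (by omega) ?_)).symm
      · intro m h₁ h₂
        rcases (show m = j' ∨ j' + 1 ≤ m by omega) with rfl | e
        · simp
        · exact Or.inr (Or.inr (Or.inl (Or.inl ⟨m, ⟨e, h₂⟩, rfl⟩)))
      · rintro x (rfl | rfl | hx)
        · rcases (show b = j' ∨ j' + 1 ≤ b by omega) with e | e
          · simp [e]
          · exact Or.inr (Or.inr (Or.inl (Or.inl ⟨b, ⟨e, le_rfl⟩, rfl⟩)))
        · rcases (show a = i' ∨ a ≤ i' - 1 by omega) with e | e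
          · simp [e]
          · exact Or.inr (Or.inr (Or.inr ⟨a, ⟨le_rfl, e⟩, rfl⟩))
        · exact Or.inr (Or.inr (Or.inl (Or.inr hx)))
      · intro m h₁ h₂
        rcases (show m = i' ∨ m ≤ i' - 1 by omega) with rfl | e
        · simp
        · exact Or.inr (Or.inr (Or.inr ⟨m, ⟨h₁, e⟩, rfl⟩))
    · rintro _ rfl _ ⟨m, ⟨h₁, h₂⟩, rfl⟩
      exact ⟨(h.ne_hub m).symm, hs m (by omega) (by omega)⟩
    · rintro _ rfl x ((⟨m, ⟨h₁, h₂⟩, rfl⟩ | hx) | ⟨m, ⟨h₁, h₂⟩, rfl⟩)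
      · exact ⟨(h.ne_hub m).symm, hl m (by omega) (by omega) (by omega) (by omega)⟩
      · exact ⟨(hP.ne_hub x hx).symm, hP.not_adj x hx⟩
      · exact ⟨(h.ne_hub m).symm, hl m (by omega) (by omega) (by omega) (by omega)⟩
    · rintro x hx y ((hy | hy) | hy)
      · exact h.cyc.anti_arc (i := i' + 1) (j := j' - 1) (k := j' + 1) (l := b) (by omega)
          (by omega) x hx y hy
      · obtain ⟨m, ⟨h₁, h₂⟩, rfl⟩ := hx
        exact ⟨hP.ne_rim y hy m, fun hc => hat m (by omega) (by omega) ⟨y, hy, hc.symm⟩⟩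
      · exact (h.cyc.anti_arc (i := a) (j := i' - 1) (k := i' + 1) (l := j' - 1) (by omega)
          (by omega)).symm x hx y hy

/-- On an arc between consecutive attachments of a set that is not local, the spokes are
consecutive. -/
theorem spokes_consecutive [Finite V] (h : Wheel G w n v) {P : Set V} (hP : Away G w v P)
    (hloc : ¬ Local G w n v P) {a b i k j : ℤ} (ha : Att G P (w a)) (hb : Att G P (w b))
    (hat : ∀ m, a < m → m < b → ¬ Att G P (w m)) (hai : a ≤ i) (hik : i < k) (hkj : k < j)
    (hjb : j ≤ b) (hi : G.Adj v (w i)) (hj : G.Adj v (w j)) : G.Adj v (w k) := by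
  by_contra hk
  apply hloc
  refine h.local_of_arc (a := b) (b := a + n) (fun m h₁ h₂ => ?_) fun m h₁ h₂ => ?_
  · exact h.no_spoke_outside hP (by omega) ha hb hat hai hik hkj hjb hi hk hj m h₁ h₂
  · have := hat (m - n) (by omega) (by omega)
    rwa [h.cyc.sub_period] at this

end Wheel

/-! ### Surroundings of a long sector -/

theorem IsCyc.add_mul_period (h : IsCyc G w n) (i c : ℤ) : w (i + n * c) = w i :=
  (h.eq_iff_dvd _ _).mpr ⟨-c, by ring⟩

namespace Wheel

/-- The complement of a sector contains a non-spoke, as there are two long sectors. -/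
theorem exists_nonspoke (h : Wheel G w n v) {x y : ℤ} (hs : IsSector G w v x y) :
    ∃ m, y < m ∧ m < x + n ∧ ¬ G.Adj v (w m) := by
  obtain ⟨i, k, j, k', h₁, h₂, h₃, h₄, hi, hk, hj, hk'⟩ := h.gaps
  obtain ⟨a, a₁, a₂, a₃⟩ := h.cyc.exists_window x k
  have hak : ¬ G.Adj v (w a) := a₃ ▸ hk
  have hax : a ≠ x := fun e => hak (e ▸ hs.left)
  have hay : a ≠ y := fun e => hak (e ▸ hs.right)
  by_cases hya : y < a
  · exact ⟨a, hya, a₂, hak⟩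
  · obtain ⟨c, hc⟩ := (h.cyc.eq_iff_dvd _ _).mp a₃
    have per : ∀ m, w (m - n * c) = w m := fun m => by
      have := h.cyc.add_mul_period m (-c)
      rwa [mul_neg, ← sub_eq_add_neg] at this
    have hix : i - n * c ≤ x := by
      by_contra
      exact hs.not_adj (i - n * c) (by omega) (by omega) (by rwa [per])
    have hjy : y ≤ j - n * c := by
      by_contra
      exact hs.not_adj (j - n * c) (by omega) (by omega) (by rwa [per])
    exact ⟨k' - n * c, by omega, by omega, by rwa [per]⟩

/-- If the spoke after `y` were the only one outside a long sector from `x` to `y`, then the hub and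
the rim would form a pyramid with apex `w x`. -/
theorem not_two_spokes_beyond (h : Wheel G w n v) {x y : ℤ} (hs : IsSector G w v x y)
    (hl : x + 2 ≤ y) (hy : G.Adj v (w (y + 1)))
    (hno : ∀ m, y + 2 ≤ m → m ≤ x + n - 1 → ¬ G.Adj v (w m)) : False := by
  have hn := h.cyc.four_le
  have hle := h.sector_le hs
  have hyx : y + 3 ≤ x + n := by
    by_contra
    obtain ⟨m, m₁, m₂, m₃⟩ := h.exists_nonspoke hs
    exact m₃ (by rwa [show m = y + 1 by omega])
  refine h.pyramid (containsPyramid_of_sets (a := w x) (b₁ := v) (b₂ := w y) (b₃ := w (y + 1))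
    (A := {v}) (B := w '' Set.Icc (x + 1) y) (C := w '' Set.Icc (y + 1) (x + n - 1))
    hs.right hy (h.cyc.adj_succ y) ?_ ?_ ?_ (by simp) ⟨y, ⟨by omega, le_rfl⟩, rfl⟩
    ⟨y + 1, ⟨le_rfl, by omega⟩, rfl⟩ ?_ ?_ ?_ ?_ ?_ ?_ ?_ ?_ ?_)
  · exact h.ne_hub x
  · rintro ⟨m, ⟨m₁, m₂⟩, e⟩
    rw [h.cyc.eq_iff (by omega) (by omega)] at e
    omega
  · rintro ⟨m, ⟨m₁, m₂⟩, e⟩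
    rw [h.cyc.eq_iff (by omega) (by omega)] at e
    omega
  · exact .of_adj (by simp) (by simp) hs.left.symm
  · refine h.cyc.linked_arc (by omega) fun m m₁ m₂ => ?_
    rcases eq_or_lt_of_le m₁ with rfl | m₃
    · simp
    · exact Or.inr ⟨m, ⟨by omega, m₂⟩, rfl⟩
  · rw [← h.cyc.add_period x]
    refine (h.cyc.linked_arc (by omega) fun m m₁ m₂ => ?_).symm
    rcases eq_or_lt_of_le m₂ with rfl | m₃
    · simp
    · exact Or.inr ⟨m, ⟨m₁, by omega⟩, rfl⟩
  · rintro ⟨-, e⟩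
    rw [h.cyc.adj_iff (by omega) (by omega)] at e
    omega
  · rintro ⟨-, e⟩
    rw [h.cyc.adj_iff (by omega) (by omega)] at e
    omega
  · rintro ⟨e, -⟩
    rw [h.cyc.adj_iff (by omega) (by omega)] at e
    omega
  · rintro _ rfl _ ⟨m, ⟨m₁, m₂⟩, rfl⟩
    refine ⟨(h.ne_hub m).symm, fun e => ⟨rfl, ?_⟩⟩
    rcases eq_or_lt_of_le m₂ with rfl | m₃
    · rfl
    · exact absurd e (hs.not_adj m (by omega) m₃)
  · rintro _ rfl _ ⟨m, ⟨m₁, m₂⟩, rfl⟩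
    refine ⟨(h.ne_hub m).symm, fun e => ⟨rfl, ?_⟩⟩
    rcases eq_or_lt_of_le m₁ with rfl | m₃
    · rfl
    · exact absurd e (hno m (by omega) m₂)
  · rintro _ ⟨m, ⟨m₁, m₂⟩, rfl⟩ _ ⟨m', ⟨m₁', m₂'⟩, rfl⟩
    rw [Ne, h.cyc.eq_iff (by omega) (by omega), h.cyc.adj_iff (by omega) (by omega)]
    refine ⟨by omega, fun e => ?_⟩
    obtain rfl : m = y := by omega
    obtain rfl : m' = m + 1 := by omega
    exact ⟨rfl, rfl⟩

/-- Some spoke is neither on a given long sector nor adjacent to it: otherwise the hub and the rim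
form a pyramid or a pinched prism. -/
theorem exists_far_spoke (h : Wheel G w n v) {x y : ℤ} (hs : IsSector G w v x y)
    (hl : x + 2 ≤ y) : ∃ z, y + 2 ≤ z ∧ z + 2 ≤ x + n ∧ G.Adj v (w z) := by
  have hn := h.cyc.four_le
  have hle := h.sector_le hs
  by_contra! hno
  by_cases hp : G.Adj v (w (y + 1)) <;> by_cases hq : G.Adj v (w (x + n - 1))
  · have hyx : y + 4 ≤ x + n := by
      by_contra
      obtain ⟨m, m₁, m₂, m₃⟩ := h.exists_nonspoke hs
      rcases (show m = y + 1 ∨ m = x + n - 1 by omega) with rfl | rfl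
      · exact m₃ hp
      · exact m₃ hq
    refine h.pinched ⟨Set.range w, v, w x, w (x + n - 1), w y, w (y + 1), h.cyc.isHole, ?_,
      fun ⟨i, hi⟩ => h.ne_hub i hi, ?_, ?_, h.cyc.adj_succ y, ?_⟩
    · rw [h.cyc.ncard_range]
      omega
    · ext t
      constructor
      · rintro ⟨ht, m, rfl⟩
        obtain ⟨a, a₁, a₂, a₃⟩ := h.cyc.exists_window x m
        rw [← a₃] at ht ⊢
        have : a = x ∨ a = x + n - 1 ∨ a = y ∨ a = y + 1 := by
          by_contra! hc
          rcases lt_or_ge a y with c | c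
          · exact hs.not_adj a (by omega) c ht
          · exact hno a (by omega) (by omega) ht
        rcases this with rfl | rfl | rfl | rfl <;> simp
      · rintro (rfl | rfl | rfl | rfl)
        · exact ⟨hs.left, x, rfl⟩
        · exact ⟨hq, _, rfl⟩
        · exact ⟨hs.right, y, rfl⟩
        · exact ⟨hp, _, rfl⟩
    · rw [h.cyc.adj_iff (by omega) (by omega)]
      omega
    · rintro s (rfl | rfl) t (rfl | rfl) <;>
      · rw [Ne, h.cyc.eq_iff (by omega) (by omega), h.cyc.adj_iff (by omega) (by omega)]
        omega
  · refine h.not_two_spokes_beyond hs hl hp fun m m₁ m₂ => ?_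
    rcases (show m = x + n - 1 ∨ m + 2 ≤ x + n by omega) with rfl | e
    · exact hq
    · exact hno m m₁ e
  · refine h.reflect.not_two_spokes_beyond hs.reflect (by omega) ?_ fun m m₁ m₂ => ?_
    · rwa [← h.cyc.add_period, show -(-x + 1) + n = x + n - 1 by ring]
    · rw [← h.cyc.add_period]
      rcases (show -m + n = y + 1 ∨ y + 2 ≤ -m + n by omega) with e | e
      · rwa [e]
      · exact hno _ e (by omega)
  · obtain ⟨m, m₁, m₂, m₃⟩ := h.third x y
    obtain ⟨a, a₁, a₂, a₃⟩ := h.cyc.exists_window x m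
    rw [← a₃] at m₁ m₂ m₃
    have c₁ : a ≠ x := fun e => m₂ (by rw [e])
    have c₂ : a ≠ y := fun e => m₃ (by rw [e])
    have c₃ : a ≠ y + 1 := fun e => hp (e ▸ m₁)
    have c₄ : a ≠ x + n - 1 := fun e => hq (e ▸ m₁)
    rcases lt_or_ge a y with c | c
    · exact hs.not_adj a (by omega) c m₁
    · exact hno a (by omega) (by omega) m₁

/-- Let `q` be linked to the hub through a set anticomplete to a long sector. Then the neighbours
of `q` on this sector amount to at most one end of it: otherwise there is a theta or a pyramid. -/
theorem false_of_anti (h : Wheel G w n v) {x y : ℤ} (hs : IsSector G w v x y) (hl : x + 2 ≤ y)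
    {A : Set V} {q : V} (hvA : v ∉ A) (hqv : q ≠ v) (hvq : ¬ G.Adj v q) (hqw : ∀ i, w i ≠ q)
    (hlink : Linked G (insert v (insert q A)) v q) (hA : Anti G A (w '' Set.Icc x y))
    {s t : ℤ} (hs₁ : x < s) (hs₂ : s ≤ y) (hs₃ : G.Adj q (w s)) (ht₁ : x ≤ t) (ht₂ : t < y)
    (ht₃ : G.Adj q (w t)) : False := by
  have hn := h.cyc.four_le
  have hle := h.sector_le hs
  -- The first and the last neighbour of `q` on the sector: if they coincide, there is a theta with
  -- ends `v` and `w α`, if they are adjacent a pyramid with apex `v`, and otherwise a theta with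
  -- ends `v` and `q`.
  obtain ⟨α, α₁, -, α₃, α₄⟩ := h.cyc.exists_next (G.Adj q) ⟨s, hs₃⟩ (x - 1)
  obtain ⟨β, β₁, -, β₃, β₄⟩ := h.cyc.exists_prev (G.Adj q) ⟨s, hs₃⟩ (y + 1)
  have hαt : α ≤ t := by
    by_contra
    exact α₄ t (by omega) (by omega) ht₃
  have hαs : α ≤ s := by
    by_contra
    exact α₄ s (by omega) (by omega) hs₃
  have hsβ : s ≤ β := by
    by_contra
    exact β₄ s (by omega) (by omega) hs₃
  have hA' : ∀ a ∈ A, ∀ m, x ≤ m → m ≤ y → a ≠ w m ∧ ¬ G.Adj a (w m) :=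
    fun a ha m h₁ h₂ => hA a ha _ ⟨m, ⟨h₁, h₂⟩, rfl⟩
  rcases (show α = β ∨ β = α + 1 ∨ α + 2 ≤ β by omega) with e | e | e
  · subst e
    refine h.theta (containsTheta_of_sets (a := v) (b := w α) (A := w '' Set.Icc x (α - 1))
      (B := w '' Set.Icc (α + 1) y) (C := insert q A) (h.ne_hub α).symm
      (hs.not_adj α (by omega) (by omega)) ?_ ?_ ?_ ?_ ?_ ?_)
    · refine Linked.trans (.of_adj (by simp) ?_ hs.left) (h.cyc.linked_arc (by omega) ?_)
      · exact Or.inr (Or.inr ⟨x, ⟨le_rfl, by omega⟩, rfl⟩)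
      · intro m m₁ m₂
        rcases eq_or_lt_of_le m₂ with rfl | m₃
        · simp
        · exact Or.inr (Or.inr ⟨m, ⟨m₁, by omega⟩, rfl⟩)
    · refine Linked.trans (.of_adj (by simp) ?_ hs.right) (h.cyc.linked_arc (by omega) ?_).symm
      · exact Or.inr (Or.inr ⟨y, ⟨by omega, le_rfl⟩, rfl⟩)
      · intro m m₁ m₂
        rcases eq_or_lt_of_le m₁ with rfl | m₃
        · simp
        · exact Or.inr (Or.inr ⟨m, ⟨by omega, m₂⟩, rfl⟩)
    · refine (hlink.mono ?_).trans (.of_adj (by simp) (by simp) α₃)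
      rintro z (rfl | rfl | hz)
      · simp
      · simp
      · simp [hz]
    · exact h.cyc.anti_arc (by omega) (by omega)
    · rintro _ ⟨m, ⟨m₁, m₂⟩, rfl⟩ z (rfl | hz)
      · exact ⟨hqw m, fun c => α₄ m (by omega) (by omega) c.symm⟩
      · have := hA' z hz m m₁ (by omega)
        exact ⟨this.1.symm, fun c => this.2 c.symm⟩
    · rintro _ ⟨m, ⟨m₁, m₂⟩, rfl⟩ z (rfl | hz)
      · exact ⟨hqw m, fun c => β₄ m (by omega) (by omega) c.symm⟩
      · have := hA' z hz m (by omega) (by omega)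
        exact ⟨this.1.symm, fun c => this.2 c.symm⟩
  · subst e
    have hvarc : ∀ i j, v ∉ w '' Set.Icc i j := by
      rintro i j ⟨m, -, hm⟩
      exact h.ne_hub m hm
    refine h.pyramid (containsPyramid_of_sets (a := v) (b₁ := q) (b₂ := w α) (b₃ := w (α + 1))
      (A := insert q A) (B := w '' Set.Icc x α) (C := w '' Set.Icc (α + 1) y) α₃ β₃
      (h.cyc.adj_succ α) ?_ (hvarc _ _) (hvarc _ _) (by simp) ⟨α, ⟨by omega, le_rfl⟩, rfl⟩
      ⟨α + 1, ⟨le_rfl, by omega⟩, rfl⟩ hlink ?_ ?_ (fun c => hvq c.1) (fun c => hvq c.1) ?_ ?_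
      ?_ ?_)
    · rintro (c | c)
      · exact hqv c.symm
      · exact hvA c
    · refine Linked.trans (.of_adj (by simp) ?_ hs.left) (h.cyc.linked_arc (by omega) ?_)
      · exact Or.inr ⟨x, ⟨le_rfl, by omega⟩, rfl⟩
      · intro m m₁ m₂
        exact Or.inr ⟨m, ⟨m₁, m₂⟩, rfl⟩
    · refine Linked.trans (.of_adj (by simp) ?_ hs.right) (h.cyc.linked_arc (by omega) ?_).symm
      · exact Or.inr ⟨y, ⟨by omega, le_rfl⟩, rfl⟩
      · intro m m₁ m₂
        exact Or.inr ⟨m, ⟨m₁, m₂⟩, rfl⟩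
    · rintro ⟨c₁, c₂⟩
      have : α = x := by
        by_contra
        exact hs.not_adj α (by omega) (by omega) c₁
      have : α + 1 = y := by
        by_contra
        exact hs.not_adj (α + 1) (by omega) (by omega) c₂
      omega
    · rintro z (rfl | hz) _ ⟨m, ⟨m₁, m₂⟩, rfl⟩
      · refine ⟨(hqw m).symm, fun c => ⟨rfl, ?_⟩⟩
        rcases eq_or_lt_of_le m₂ with rfl | m₃
        · rfl
        · exact absurd c (α₄ m (by omega) m₃)
      · have := hA' z hz m m₁ (by omega)
        exact ⟨this.1, fun c => absurd c this.2⟩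
    · rintro z (rfl | hz) _ ⟨m, ⟨m₁, m₂⟩, rfl⟩
      · refine ⟨(hqw m).symm, fun c => ⟨rfl, ?_⟩⟩
        rcases eq_or_lt_of_le m₁ with rfl | m₃
        · rfl
        · exact absurd c (β₄ m m₃ (by omega))
      · have := hA' z hz m (by omega) m₂
        exact ⟨this.1, fun c => absurd c this.2⟩
    · rintro _ ⟨m, ⟨m₁, m₂⟩, rfl⟩ _ ⟨m', ⟨m₁', m₂'⟩, rfl⟩
      rw [Ne, h.cyc.eq_iff (by omega) (by omega), h.cyc.adj_iff (by omega) (by omega)]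
      refine ⟨by omega, fun e => ?_⟩
      obtain rfl : m = α := by omega
      obtain rfl : m' = m + 1 := by omega
      exact ⟨rfl, rfl⟩
  · refine h.theta (containsTheta_of_sets (a := v) (b := q) (A := w '' Set.Icc x α)
      (B := w '' Set.Icc β y) (C := A) hqv.symm hvq ?_ ?_ hlink ?_ ?_ ?_)
    · refine Linked.trans (.of_adj (by simp) ?_ hs.left)
        ((h.cyc.linked_arc (i := x) (j := α) (by omega) ?_).trans (.of_adj ?_ (by simp) α₃.symm))
      · exact Or.inr (Or.inr ⟨x, ⟨le_rfl, by omega⟩, rfl⟩)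
      · intro m m₁ m₂
        exact Or.inr (Or.inr ⟨m, ⟨m₁, m₂⟩, rfl⟩)
      · exact Or.inr (Or.inr ⟨α, ⟨by omega, le_rfl⟩, rfl⟩)
    · refine Linked.trans (.of_adj (by simp) ?_ hs.right)
        ((h.cyc.linked_arc (i := β) (j := y) (by omega) ?_).symm.trans
          (.of_adj ?_ (by simp) β₃.symm))
      · exact Or.inr (Or.inr ⟨y, ⟨by omega, le_rfl⟩, rfl⟩)
      · intro m m₁ m₂
        exact Or.inr (Or.inr ⟨m, ⟨m₁, m₂⟩, rfl⟩)
      · exact Or.inr (Or.inr ⟨β, ⟨le_rfl, by omega⟩, rfl⟩)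
    · exact h.cyc.anti_arc (by omega) (by omega)
    · rintro _ ⟨m, ⟨m₁, m₂⟩, rfl⟩ z hz
      have := hA' z hz m m₁ (by omega)
      exact ⟨this.1.symm, fun c => this.2 c.symm⟩
    · rintro _ ⟨m, ⟨m₁, m₂⟩, rfl⟩ z hz
      have := hA' z hz m (by omega) m₂
      exact ⟨this.1.symm, fun c => this.2 c.symm⟩

end Wheel

/-! ### Single vertices attached to several sectors -/

@[simp]
theorem att_singleton {u x : V} : Att G {u} x ↔ G.Adj u x := by
  simp [Att]

theorem Away.singleton {P : Set V} (h : Away G w v P) {u : V} (hu : u ∈ P) :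
    Away G w v {u} where
  linked := by
    rintro x rfl y rfl
    exact .refl rfl
  ne_rim := by
    rintro x rfl
    exact h.ne_rim x hu
  ne_hub := by
    rintro x rfl
    exact h.ne_hub x hu
  not_adj := by
    rintro x rfl
    exact h.not_adj x hu

/-- The wheel has exactly two long sectors, from `i` to `x` and from `x` to `j`; the spokes other
than `x` form the arc from `j` to `i + n`, which has at least three vertices. -/
structure IsLone (G : SimpleGraph V) (w : ℤ → V) (n : ℤ) (v : V) (i x j : ℤ) : Prop where
  left_le : i + 2 ≤ x
  right_le : x + 2 ≤ j
  far_le : j + 2 ≤ i + n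
  spoke : G.Adj v (w x)
  left : ∀ m, i < m → m < x → ¬ G.Adj v (w m)
  right : ∀ m, x < m → m < j → ¬ G.Adj v (w m)
  far : ∀ m, j ≤ m → m ≤ i + n → G.Adj v (w m)

theorem IsLone.reflect (hw : IsCyc G w n) {i x j : ℤ} (h : IsLone G w n v i x j) :
    IsLone G (fun i => w (-i)) n v (-j) (-x) (-i) where
  left_le := by have := h.right_le; omega
  right_le := by have := h.left_le; omega
  far_le := by have := h.far_le; omega
  spoke := by simpa using h.spoke
  left m h₁ h₂ := h.right _ (by omega) (by omega)
  right m h₁ h₂ := h.left _ (by omega) (by omega)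
  far m h₁ h₂ := by
    have := h.far (-m + n) (by omega) (by omega)
    rwa [hw.add_period] at this

theorem IsLone.congr {w' : ℤ → V} (e : w' = w) {i x j i' x' j' : ℤ} (hi : i' = i) (hx : x' = x)
    (hj : j' = j) (h : IsLone G w' n v i' x' j') : IsLone G w n v i x j := by
  subst e hi hx hj
  exact h

/-- The neighbours of `u` on the rim are the two rim neighbours of the isolated spoke `x` and
possibly `x` itself. -/
structure IsClone (G : SimpleGraph V) (w : ℤ → V) (n : ℤ) (u : V) (x : ℤ) : Prop where
  pred : G.Adj u (w (x - 1))
  succ : G.Adj u (w (x + 1))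
  not_adj : ∀ m, x + 2 ≤ m → m + 2 ≤ x + n → ¬ G.Adj u (w m)

namespace Wheel

/-- If the neighbours of `u` on a long sector are not confined to one end of it, then outside of it
they are among the two rim vertices next to it. -/
theorem not_adj_far (h : Wheel G w n v) {u : V} (hu : Away G w v {u}) {x y : ℤ}
    (hs : IsSector G w v x y) (hl : x + 2 ≤ y) {s t : ℤ} (hs₁ : x < s) (hs₂ : s ≤ y)
    (hs₃ : G.Adj u (w s)) (ht₁ : x ≤ t) (ht₂ : t < y) (ht₃ : G.Adj u (w t)) (m : ℤ)
    (hm₁ : y + 2 ≤ m) (hm₂ : m + 2 ≤ x + n) : ¬ G.Adj u (w m) := by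
  intro hm
  obtain ⟨z, z₁, z₂, hz⟩ := h.exists_far_spoke hs hl
  have hmem : ∀ k, min z m ≤ k → k ≤ max z m → w k ∈ w '' Set.Icc (min z m) (max z m) :=
    fun k h₁ h₂ => ⟨k, ⟨h₁, h₂⟩, rfl⟩
  have hzm : Linked G (w '' Set.Icc (min z m) (max z m)) (w z) (w m) := by
    rcases le_total z m with c | c
    · exact h.cyc.linked_arc c fun k k₁ k₂ => hmem k (by omega) (by omega)
    · exact (h.cyc.linked_arc c fun k k₁ k₂ => hmem k (by omega) (by omega)).symm
  refine h.false_of_anti hs hl (A := w '' Set.Icc (min z m) (max z m)) (q := u) ?_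
    (hu.ne_hub u rfl) (hu.not_adj u rfl) (hu.ne_rim u rfl) ?_
    (h.cyc.anti_arc (by omega) (by omega)).symm hs₁ hs₂ hs₃ ht₁ ht₂ ht₃
  · rintro ⟨k, -, e⟩
    exact h.ne_hub k e
  · have h₁ := hmem z (by omega) (by omega)
    have h₂ := hmem m (by omega) (by omega)
    have hsub : w '' Set.Icc (min z m) (max z m) ⊆
        insert v (insert u (w '' Set.Icc (min z m) (max z m))) := fun k hk => Or.inr (Or.inr hk)
    exact (Linked.of_adj (Set.mem_insert v _) (hsub h₁) hz).trans
      ((hzm.mono hsub).trans (.of_adj (hsub h₂) (Or.inr (Or.inl rfl)) hm.symm))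

/-- In the situation of `not_adj_far`, a vertex attached on one side of the sector only is a clone
of the end of the sector on that side. -/
theorem isClone_of_one_side [Finite V] (h : Wheel G w n v) {u : V} (hu : Away G w v {u})
    (hloc : ¬ Local G w n v {u}) {x y : ℤ}
    (hs : IsSector G w v x y) (hl : x + 2 ≤ y) {s t : ℤ} (hs₁ : x < s) (hs₂ : s ≤ y)
    (hs₃ : G.Adj u (w s)) (ht₁ : x ≤ t) (ht₂ : t < y) (ht₃ : G.Adj u (w t))
    (hy : G.Adj u (w (y + 1))) (hx : ¬ G.Adj u (w (x + n - 1))) :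
    ∃ j, IsLone G w n v x y j ∧ IsClone G w n u y := by
  have hn := h.cyc.four_le
  have hle := h.sector_le hs
  have hfar := h.not_adj_far hu hs hl hs₁ hs₂ hs₃ ht₁ ht₂ ht₃
  obtain ⟨z, z₁, z₂, hz⟩ := h.exists_far_spoke hs hl
  obtain ⟨a, a₁, -, a₃, a₄⟩ := h.cyc.exists_next (G.Adj u) ⟨s, hs₃⟩ (x - 1)
  have hat : a ≤ t := by
    by_contra
    exact a₄ t (by omega) (by omega) ht₃
  -- The spokes between the attachments `y + 1` and `a + n` are consecutive.
  have hcons : ∀ i k j, y + 1 ≤ i → i < k → k < j → j ≤ a + n → G.Adj v (w i) →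
      G.Adj v (w j) → G.Adj v (w k) := fun i k j h₁ h₂ h₃ h₄ => by
    refine h.spokes_consecutive hu hloc (a := y + 1) (b := a + n) (by simpa using hy)
      (by simpa [h.cyc.add_period] using a₃) (fun m m₁ m₂ hm => ?_) h₁ h₂ h₃ h₄
    rw [att_singleton] at hm
    rcases (show m + 2 ≤ x + n ∨ m = x + n - 1 ∨ x + n ≤ m by omega) with c | rfl | c
    · exact hfar m (by omega) c hm
    · exact hx hm
    · exact a₄ (m - n) (by omega) (by omega) (by rwa [h.cyc.sub_period])
  have hxn : G.Adj v (w (x + n)) := by rw [h.cyc.add_period]; exact hs.left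
  have hy₁ : ¬ G.Adj v (w (y + 1)) := by
    intro hc
    obtain ⟨m, m₁, m₂, m₃⟩ := h.exists_nonspoke hs
    rcases (show m = y + 1 ∨ y + 1 < m by omega) with rfl | c
    · exact m₃ hc
    · exact m₃ (hcons _ _ _ le_rfl c m₂ (by omega) hc hxn)
  obtain ⟨y', y₁, -, y₃, y₄⟩ := h.cyc.exists_next (G.Adj v) h.exists_spoke y
  have hyz : y' ≤ z := by
    by_contra
    exact y₄ z (by omega) (by omega) hz
  have hyy : y' ≠ y + 1 := fun e => hy₁ (e ▸ y₃)
  have hs' : IsSector G w v y y' := ⟨y₁, hs.right, y₃, y₄⟩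
  have hfar' := h.not_adj_far hu hs' (by omega) (s := y + 1) (t := y + 1) (by omega) (by omega) hy
    (by omega) (by omega) hy
  have hin : ∀ m, x ≤ m → m + 2 ≤ y → ¬ G.Adj u (w m) := fun m m₁ m₂ hm =>
    hfar' (m + n) (by omega) (by omega) (by rwa [h.cyc.add_period])
  have hty : t = y - 1 := by
    by_contra
    exact hin t ht₁ (by omega) ht₃
  refine ⟨y', ⟨hl, by omega, by omega, hs.right, hs.not_adj, y₄, fun m m₁ m₂ => ?_⟩,
    ⟨hty ▸ ht₃, hy, fun m m₁ m₂ hm => ?_⟩⟩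
  · rcases (show m = y' ∨ m = x + n ∨ (y' < m ∧ m < x + n) by omega) with rfl | rfl | c
    · exact y₃
    · exact hxn
    · exact hcons _ _ _ (by omega) c.1 c.2 (by omega) y₃ hxn
  · rcases (show m + 2 ≤ x + n ∨ m = x + n - 1 ∨ x + n ≤ m by omega) with c | rfl | c
    · exact hfar m m₁ c hm
    · exact hx hm
    · exact hin (m - n) (by omega) (by omega) (by rwa [h.cyc.sub_period])

/-- A vertex attached on both sides beyond a long sector would yield a prism, a pyramid or the
cube. -/
theorem false_of_both_sides [Finite V] (h : Wheel G w n v) {u : V} (hu : Away G w v {u})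
    (hloc : ¬ Local G w n v {u}) {x y : ℤ}
    (hs : IsSector G w v x y) (hl : x + 2 ≤ y) {s t : ℤ} (hs₁ : x < s) (hs₂ : s ≤ y)
    (hs₃ : G.Adj u (w s)) (ht₁ : x ≤ t) (ht₂ : t < y) (ht₃ : G.Adj u (w t))
    (hy : G.Adj u (w (y + 1))) (hx : G.Adj u (w (x + n - 1))) (hy₁ : ¬ G.Adj v (w (y + 1))) :
    False := by
  have hn := h.cyc.four_le
  have hle := h.sector_le hs
  have hfar := h.not_adj_far hu hs hl hs₁ hs₂ hs₃ ht₁ ht₂ ht₃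
  obtain ⟨z, z₁, z₂, hz⟩ := h.exists_far_spoke hs hl
  obtain ⟨y', y₁, -, y₃, y₄⟩ := h.cyc.exists_next (G.Adj v) h.exists_spoke y
  have hyz : y' ≤ z := by
    by_contra
    exact y₄ z (by omega) (by omega) hz
  have hyy : y' ≠ y + 1 := fun e => hy₁ (e ▸ y₃)
  have hs' : IsSector G w v y y' := ⟨y₁, hs.right, y₃, y₄⟩
  have hfar' := h.not_adj_far hu hs' (by omega) (s := y + 1) (t := y + 1) (by omega) (by omega) hy
    (by omega) (by omega) hy
  have hxy' : x + n = y' + 2 := by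
    by_contra
    exact hfar' (x + n - 1) (by omega) (by omega) hx
  have hin : ∀ m, x ≤ m → m + 2 ≤ y → ¬ G.Adj u (w m) := fun m m₁ m₂ hm =>
    hfar' (m + n) (by omega) (by omega) (by rwa [h.cyc.add_period])
  have hty : t = y - 1 := by
    by_contra
    exact hin t ht₁ (by omega) ht₃
  subst hty
  have hvu := hu.not_adj u rfl
  have huv := hu.ne_hub u rfl
  have huw := hu.ne_rim u rfl
  have hxx : G.Adj (w (x + n - 1)) (w x) := by
    rw [h.cyc.adj_iff (by omega) (by omega)]; omega
  have hyx : w y ≠ w (x + n - 1) ∧ ¬ G.Adj (w y) (w (x + n - 1)) := by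
    rw [Ne, h.cyc.eq_iff (by omega) (by omega), h.cyc.adj_iff (by omega) (by omega)]
    omega
  have hvy : ∀ m, x ≤ m → m < y → G.Adj v (w m) → m = x := fun m m₁ m₂ hm => by
    by_contra
    exact hs.not_adj m (by omega) m₂ hm
  by_cases hsp : G.Adj v (w (x + n - 1))
  · -- The edge from `w (x + n - 1)` to `w x` and the hub form a triangle of a prism or a pyramid.
    by_cases huy : G.Adj u (w y)
    · refine h.prism (containsPrism_of_sets (a₁ := w y) (a₂ := u) (a₃ := w (y - 1)) (b₁ := v)
        (b₂ := w (x + n - 1)) (b₃ := w x) (A := {w y, v}) (B := {u, w (x + n - 1)})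
        (C := w '' Set.Icc x (y - 1)) hsp hs.left hxx huy.symm ?_ ht₃ (h.ne_hub y) (huw _).symm ?_
        (.of_adj (by simp) (by simp) hs.right.symm) (.of_adj (by simp) (by simp) hx)
        (h.cyc.linked_arc (A := w '' Set.Icc x (y - 1)) (by omega)
          fun m m₁ m₂ => ⟨m, ⟨m₁, m₂⟩, rfl⟩).symm ?_ ?_ ?_)
      · rw [h.cyc.adj_iff (by omega) (by omega)]; omega
      · rw [Ne, h.cyc.eq_iff (by omega) (by omega)]; omega
      · rintro _ (rfl | rfl) _ (rfl | rfl)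
        · exact ⟨huw y, fun _ => Or.inl ⟨rfl, rfl⟩⟩
        · exact ⟨hyx.1, fun c => absurd c hyx.2⟩
        · exact ⟨huv.symm, fun c => absurd c hvu⟩
        · exact ⟨(h.ne_hub _).symm, fun _ => Or.inr ⟨rfl, rfl⟩⟩
      · rintro _ (rfl | rfl) _ ⟨m, ⟨m₁, m₂⟩, rfl⟩
        · rw [Ne, h.cyc.eq_iff (by omega) (by omega), h.cyc.adj_iff (by omega) (by omega)]
          refine ⟨by omega, fun c => Or.inl ⟨rfl, ?_⟩⟩
          congr 1
          omega
        · exact ⟨(h.ne_hub _).symm, fun c => Or.inr ⟨rfl, by rw [hvy m m₁ (by omega) c]⟩⟩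
      · rintro _ (rfl | rfl) _ ⟨m, ⟨m₁, m₂⟩, rfl⟩
        · refine ⟨(huw m).symm, fun c => Or.inl ⟨rfl, ?_⟩⟩
          congr 1
          by_contra
          exact hin m m₁ (by omega) c
        · rw [Ne, h.cyc.eq_iff (by omega) (by omega), h.cyc.adj_iff (by omega) (by omega)]
          refine ⟨by omega, fun c => Or.inr ⟨rfl, ?_⟩⟩
          congr 1
          omega
    · have hyC : ∀ m, x ≤ m → m ≤ y - 2 → w (y - 1) ≠ w m ∧ w y ≠ w m ∧ ¬ G.Adj (w y) (w m) := by
        intro m m₁ m₂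
        rw [Ne, Ne, h.cyc.eq_iff (by omega) (by omega), h.cyc.eq_iff (by omega) (by omega),
          h.cyc.adj_iff (by omega) (by omega)]
        omega
      have hne : w (y - 1) ≠ w y ∧ w (y - 1) ≠ w (x + n - 1) ∧
          ¬ G.Adj (w (y - 1)) (w (x + n - 1)) ∧ G.Adj (w (y - 1)) (w y) := by
        rw [Ne, Ne, h.cyc.eq_iff (by omega) (by omega), h.cyc.eq_iff (by omega) (by omega),
          h.cyc.adj_iff (by omega) (by omega), h.cyc.adj_iff (by omega) (by omega)]
        omega
      have hvy₁ : ¬ G.Adj (w (y - 1)) v := fun c => by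
        have := hvy (y - 1) (by omega) (by omega) c.symm
        omega
      refine h.pyramid (containsPyramid_of_sets (a := w (y - 1)) (b₁ := v) (b₂ := w (x + n - 1))
        (b₃ := w x) (A := {w y, v}) (B := {u, w (x + n - 1)}) (C := w '' Set.Icc x (y - 2))
        hsp hs.left hxx ?_ ?_ ?_ (by simp) (by simp) ⟨x, ⟨le_rfl, by omega⟩, rfl⟩
        ((Linked.of_adj (y := w y) (by simp) (by simp) hne.2.2.2).trans
          (.of_adj (by simp) (by simp) hs.right.symm))
        ((Linked.of_adj (y := u) (by simp) (by simp) ht₃.symm).trans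
          (.of_adj (by simp) (by simp) hx)) ?_ (fun c => hvy₁ c.1) (fun c => hvy₁ c.1)
        (fun c => hne.2.2.1 c.1) ?_ ?_ ?_)
      · rintro (c | c)
        · exact hne.1 c
        · exact h.ne_hub _ c
      · rintro (c | c)
        · exact huw _ c
        · exact hne.2.1 c
      · rintro ⟨m, ⟨m₁, m₂⟩, c⟩
        exact (hyC m m₁ m₂).1 c.symm
      · refine (h.cyc.linked_arc (by omega) fun m m₁ m₂ => ?_).symm
        rcases eq_or_lt_of_le m₂ with rfl | c
        · simp
        · exact Or.inr ⟨m, ⟨m₁, by omega⟩, rfl⟩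
      · rintro _ (rfl | rfl) _ (rfl | rfl)
        · exact ⟨huw y, fun c => absurd c.symm huy⟩
        · exact ⟨hyx.1, fun c => absurd c hyx.2⟩
        · exact ⟨huv.symm, fun c => absurd c hvu⟩
        · exact ⟨(h.ne_hub _).symm, fun _ => ⟨rfl, rfl⟩⟩
      · rintro _ (rfl | rfl) _ ⟨m, ⟨m₁, m₂⟩, rfl⟩
        · exact ⟨(hyC m m₁ m₂).2.1, fun c => absurd c (hyC m m₁ m₂).2.2⟩
        · exact ⟨(h.ne_hub _).symm, fun c => ⟨rfl, by rw [hvy m m₁ (by omega) c]⟩⟩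
      · rintro _ (rfl | rfl) _ ⟨m, ⟨m₁, m₂⟩, rfl⟩
        · exact ⟨(huw m).symm, fun c => absurd c (hin m m₁ (by omega))⟩
        · rw [Ne, h.cyc.eq_iff (by omega) (by omega), h.cyc.adj_iff (by omega) (by omega)]
          refine ⟨by omega, fun c => ⟨rfl, ?_⟩⟩
          congr 1
          omega
  · -- The third sector, from `y'` to `x + n`, is long as well, which forces `n = 6`.
    have hs'' : IsSector G w v y' (x + n) := ⟨by omega, y₃, by rw [h.cyc.add_period]; exact hs.left,
      fun m m₁ m₂ => by rwa [show m = x + n - 1 by omega]⟩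
    have hfar'' := h.not_adj_far hu hs'' (by omega) (s := x + n - 1) (t := x + n - 1) (by omega)
      (by omega) hx (by omega) (by omega) hx
    have e₁ : y = x + 2 := by
      by_contra
      exact hfar'' (y - 1 + n) (by omega) (by omega) (by rwa [h.cyc.add_period])
    have e₂ : y' = x + 4 := by
      by_contra
      exact hfar'' (y + 1 + n) (by omega) (by omega) (by rwa [h.cyc.add_period])
    obtain rfl : n = 6 := by omega
    subst e₁ e₂
    have hv : ∀ k, 0 ≤ k → k < 6 → (G.Adj v (w (x + k)) ↔ k % 2 = 0) := by
      intro k k₁ k₂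
      obtain rfl | rfl | rfl | rfl | rfl | rfl :
        k = 0 ∨ k = 1 ∨ k = 2 ∨ k = 3 ∨ k = 4 ∨ k = 5 := by omega
      · simpa using hs.left
      · simpa using hs.not_adj (x + 1) (by omega) (by omega)
      · simpa using hs.right
      · simpa [add_assoc] using hy₁
      · simpa using y₃
      · simpa [add_sub_assoc] using hsp
    have hu' : ∀ k, 0 ≤ k → k < 6 → (G.Adj u (w (x + k)) ↔ k % 2 = 1) := by
      intro k k₁ k₂
      obtain rfl | rfl | rfl | rfl | rfl | rfl :
        k = 0 ∨ k = 1 ∨ k = 2 ∨ k = 3 ∨ k = 4 ∨ k = 5 := by omega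
      · simpa using hin x le_rfl (by omega)
      · simpa [add_sub_assoc] using ht₃
      · have := hfar'' (x + 2 + 6) (by omega) (by omega)
        rw [h.cyc.add_period] at this
        simpa using this
      · simpa [add_assoc] using hy
      · simpa using hfar (x + 4) (by omega) (by omega)
      · simpa [add_sub_assoc] using hx
    have hww : ∀ i j : Fin 6, G.Adj (w (x + i.val)) (w (x + j.val)) ↔ (cycleGraph 6).Adj i j := by
      intro i j
      rw [h.cyc.adj_iff (by omega) (by omega), cycleGraph_adj']
      revert i j
      simp only [add_assoc, add_right_inj, add_sub_assoc]
      decide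
    let f : Fin 6 ⊕ Fin 2 → V := Sum.elim (fun i => w (x + i.val)) ![v, u]
    refine h.cube ⟨⟨⟨f, ?_⟩, ?_⟩⟩
    · rintro (i | i) (j | j) hij
      · have hij : w (x + i.val) = w (x + j.val) := hij
        rw [h.cyc.eq_iff (by omega) (by omega)] at hij
        congr 1
        omega
      · fin_cases j
        · exact absurd hij (h.ne_hub _)
        · exact absurd hij (huw _)
      · fin_cases i
        · exact absurd hij.symm (h.ne_hub _)
        · exact absurd hij.symm (huw _)
      · fin_cases i <;> fin_cases j
        · rfl
        · exact absurd hij huv.symm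
        · exact absurd hij huv
        · rfl
    · rintro (i | i) (j | j)
      · exact hww i j
      · fin_cases j
        · change G.Adj (w (x + i.val)) v ↔ i.val % 2 = 0
          rw [G.adj_comm, hv _ (by omega) (by omega)]
          omega
        · change G.Adj (w (x + i.val)) u ↔ i.val % 2 = 1
          rw [G.adj_comm, hu' _ (by omega) (by omega)]
          omega
      · fin_cases i
        · change G.Adj v (w (x + j.val)) ↔ j.val % 2 = 0
          rw [hv _ (by omega) (by omega)]
          omega
        · change G.Adj u (w (x + j.val)) ↔ j.val % 2 = 1
          rw [hu' _ (by omega) (by omega)]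
          omega
      · fin_cases i <;> fin_cases j
        · exact iff_of_false G.irrefl id
        · exact iff_of_false hvu id
        · exact iff_of_false (fun c => hvu c.symm) id
        · exact iff_of_false G.irrefl id

/-- A single vertex which is not local is a clone of an isolated spoke. -/
theorem exists_isClone [Finite V] (h : Wheel G w n v) {u : V} (hu : Away G w v {u})
    (hloc : ¬ Local G w n v {u}) :
    ∃ i x j, IsLone G w n v i x j ∧ IsClone G w n u x := by
  have hn := h.cyc.four_le
  by_cases hprop : ∃ x y s t, IsSector G w v x y ∧ x + 2 ≤ y ∧ x < s ∧ s ≤ y ∧ G.Adj u (w s) ∧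
      x ≤ t ∧ t < y ∧ G.Adj u (w t)
  · obtain ⟨x, y, s, t, hs, hl, hs₁, hs₂, hs₃, ht₁, ht₂, ht₃⟩ := hprop
    have hle := h.sector_le hs
    have hfar := h.not_adj_far hu hs hl hs₁ hs₂ hs₃ ht₁ ht₂ ht₃
    have hr := hs.reflect
    have hur := hu.reflect
    have hlr := not_local_reflect h hloc
    have per : w (-(-x + 1)) = w (x + n - 1) := by
      rw [← h.cyc.add_period]; congr 1; ring
    have per' : w (-(-y + n - 1)) = w (y + 1) := by
      rw [← h.cyc.add_period]; congr 1; ring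
    by_cases hy : G.Adj u (w (y + 1)) <;> by_cases hx : G.Adj u (w (x + n - 1))
    · exfalso
      by_cases hy₁ : G.Adj v (w (y + 1))
      · by_cases hx₁ : G.Adj v (w (x + n - 1))
        · -- All vertices outside the sector are spokes.
          obtain ⟨m, m₁, m₂, m₃⟩ := h.exists_nonspoke hs
          apply m₃
          rcases (show m = y + 1 ∨ m = x + n - 1 ∨ (y + 1 < m ∧ m < x + n - 1) by omega)
            with rfl | rfl | c
          · exact hy₁
          · exact hx₁
          · refine h.spokes_consecutive hu hloc (by simpa using hy) (by simpa using hx)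
              (fun k k₁ k₂ => ?_) le_rfl c.1 c.2 le_rfl hy₁ hx₁
            rw [att_singleton]
            exact hfar k (by omega) (by omega)
        · exact h.reflect.false_of_both_sides hur hlr hr (by omega) (s := -t) (t := -s) (by omega)
            (by omega) (by simpa using ht₃) (by omega) (by omega) (by simpa using hs₃)
            (by rwa [per]) (by rwa [per']) (by rwa [per])
      · exact h.false_of_both_sides hu hloc hs hl hs₁ hs₂ hs₃ ht₁ ht₂ ht₃ hy hx hy₁
    · obtain ⟨j, hj, hc⟩ := h.isClone_of_one_side hu hloc hs hl hs₁ hs₂ hs₃ ht₁ ht₂ ht₃ hy hx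
      exact ⟨x, y, j, hj, hc⟩
    · obtain ⟨j, hj, hc⟩ := h.reflect.isClone_of_one_side hur hlr hr (by omega) (s := -t) (t := -s)
        (by omega) (by omega) (by simpa using ht₃) (by omega) (by omega) (by simpa using hs₃)
        (by rwa [per]) (by rwa [per'])
      refine ⟨-j, x, y, (hj.reflect h.reflect.cyc).congr (reflect_reflect w) rfl (by ring)
        (by ring), ?_, ?_, fun m m₁ m₂ => ?_⟩
      · simpa [add_comm, ← sub_eq_add_neg] using hc.succ
      · simpa [add_comm] using hc.pred
      · have := hc.not_adj (-m + n) (by omega) (by omega)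
        rwa [neg_add, neg_neg, ← sub_eq_add_neg, h.cyc.sub_period] at this
    · exfalso
      refine hloc ⟨x, y, hs, fun m m₁ m₂ => ?_⟩
      rw [att_singleton]
      rcases (show m = y + 1 ∨ m = x + n - 1 ∨ (y + 2 ≤ m ∧ m + 2 ≤ x + n) by omega)
        with rfl | rfl | c
      · exact hy
      · exact hx
      · exact hfar m c.1 c.2
  · -- Now all attachments are spokes; look around a vertex which is not a spoke.
    exfalso
    obtain ⟨-, k, -, -, -, -, -, -, -, hk, -, -⟩ := h.gaps
    have hsp : ∀ m, G.Adj u (w m) → G.Adj v (w m) := by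
      intro m hm
      by_contra hvm
      obtain ⟨x, x₁, -, x₃, x₄⟩ := h.cyc.exists_prev (G.Adj v) h.exists_spoke m
      obtain ⟨y, y₁, -, y₃, y₄⟩ := h.cyc.exists_next (G.Adj v) h.exists_spoke m
      refine hprop ⟨x, y, m, m, ⟨by omega, x₃, y₃, fun l l₁ l₂ => ?_⟩, by omega, x₁, by omega, hm,
        by omega, y₁, hm⟩
      rcases lt_trichotomy l m with c | rfl | c
      · exact x₄ l l₁ c
      · exact hvm
      · exact y₄ l c l₂
    obtain ⟨m₀, hm₀⟩ := h.exists_att_of_not_local hloc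
    rw [att_singleton] at hm₀
    obtain ⟨a, a₁, -, a₃, a₄⟩ := h.cyc.exists_prev (G.Adj u) ⟨m₀, hm₀⟩ k
    obtain ⟨b, b₁, -, b₃, b₄⟩ := h.cyc.exists_next (G.Adj u) ⟨m₀, hm₀⟩ k
    refine hk (h.spokes_consecutive hu hloc (a := a) (b := b) (by simpa using a₃)
      (by simpa using b₃) (fun m m₁ m₂ => ?_) le_rfl a₁ b₁ le_rfl (hsp a a₃) (hsp b b₃))
    rw [att_singleton]
    rcases lt_trichotomy m k with c | rfl | c
    · exact a₄ m m₁ c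
    · exact fun hc => hk (hsp m hc)
    · exact b₄ m c m₂

end Wheel

/-! ### Paths attached to two sectors -/

/-- `K ∪ K'` models a path from `p` to `p'` away from the wheel: `K` is all of it but `p'`, and `K'`
is all of it but `p`. Only the connectedness of these sets is retained. -/
structure IsSplit (G : SimpleGraph V) (w : ℤ → V) (v : V) (K K' : Set V) (p p' : V) : Prop where
  away : Away G w v (K ∪ K')
  away_left : Away G w v K
  away_right : Away G w v K'
  mem_left : p ∈ K
  mem_right : p' ∈ K'
  left : ∀ x ∈ K, x = p ∨ x ∈ K'
  right : ∀ x ∈ K', x = p' ∨ x ∈ K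
  adj_left : ∃ x ∈ K', G.Adj x p
  adj_right : ∃ x ∈ K, G.Adj x p'

theorem IsSplit.reflect {K K' : Set V} {p p' : V} (h : IsSplit G w v K K' p p') :
    IsSplit G (fun i => w (-i)) v K K' p p' :=
  ⟨h.away.reflect, h.away_left.reflect, h.away_right.reflect, h.mem_left, h.mem_right, h.left,
    h.right, h.adj_left, h.adj_right⟩

theorem IsSector.add_mul_period (hw : IsCyc G w n) {i j : ℤ} (h : IsSector G w v i j) (c : ℤ) :
    IsSector G w v (i + n * c) (j + n * c) where
  lt := by have := h.lt; omega
  left := by rw [hw.add_mul_period]; exact h.left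
  right := by rw [hw.add_mul_period]; exact h.right
  not_adj m h₁ h₂ := by
    have := h.not_adj (m - n * c) (by omega) (by omega)
    rwa [← hw.add_mul_period _ c, sub_add_cancel] at this

theorem Local.exists_window (hw : IsCyc G w n) {P : Set V} (h : Local G w n v P) (c : ℤ) :
    ∃ i j, c ≤ i ∧ i < c + n ∧ IsSector G w v i j ∧ ∀ m, j < m → m < i + n → ¬ Att G P (w m) := by
  obtain ⟨i, j, hs, hm⟩ := h
  obtain ⟨a, a₁, a₂, a₃⟩ := hw.exists_window c i
  obtain ⟨d, hd⟩ := (hw.eq_iff_dvd _ _).mp a₃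
  have e : a = i + n * (-d) := by rw [mul_neg]; omega
  refine ⟨i + n * (-d), j + n * (-d), by omega, by omega, hs.add_mul_period hw _,
    fun m m₁ m₂ => ?_⟩
  rw [mul_neg] at m₁ m₂
  have := hm (m + n * d) (by omega) (by omega)
  rwa [hw.add_mul_period] at this

namespace Wheel

/-- Let `L` be a connected set that is not attached to a long sector but is attached to the rim away
from it. Then a vertex `q` adjacent to `L` has its neighbours on this sector in one end of it. -/
theorem false_of_far_att (h : Wheel G w n v) {x y : ℤ} (hs : IsSector G w v x y)
    (hl : x + 2 ≤ y) {L : Set V} (hL : Away G w v L) {q : V} (hq : Away G w v {q})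
    (hqL : ∃ z ∈ L, G.Adj z q) (hno : ∀ m, x ≤ m → m ≤ y → ¬ Att G L (w m))
    {m : ℤ} (hm₁ : y + 2 ≤ m) (hm₂ : m + 2 ≤ x + n) (hm : Att G L (w m))
    {s t : ℤ} (hs₁ : x < s) (hs₂ : s ≤ y)
    (hs₃ : G.Adj q (w s)) (ht₁ : x ≤ t) (ht₂ : t < y) (ht₃ : G.Adj q (w t)) : False := by
  obtain ⟨z, z₁, z₂, hz⟩ := h.exists_far_spoke hs hl
  obtain ⟨r, hr, hrm⟩ := hm
  obtain ⟨r', hr', hrq⟩ := hqL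
  set B := w '' Set.Icc (min z m) (max z m) with hB
  have hmem : ∀ k, min z m ≤ k → k ≤ max z m → w k ∈ B :=
    fun k h₁ h₂ => ⟨k, ⟨h₁, h₂⟩, rfl⟩
  have hzm : Linked G B (w z) (w m) := by
    rcases le_total z m with c | c
    · exact h.cyc.linked_arc c fun k k₁ k₂ => hmem k (by omega) (by omega)
    · exact (h.cyc.linked_arc c fun k k₁ k₂ => hmem k (by omega) (by omega)).symm
  have hsub : B ⊆ insert v (insert q (B ∪ L)) := fun k hk => Or.inr (Or.inr (Or.inl hk))
  have hsub' : L ⊆ insert v (insert q (B ∪ L)) := fun k hk => Or.inr (Or.inr (Or.inr hk))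
  refine h.false_of_anti hs hl (A := B ∪ L) (q := q) ?_ (hq.ne_hub q rfl) (hq.not_adj q rfl)
    (hq.ne_rim q rfl) ?_ ?_ hs₁ hs₂ hs₃ ht₁ ht₂ ht₃
  · rintro (⟨k, -, e⟩ | c)
    · exact h.ne_hub k e
    · exact hL.ne_hub v c rfl
  · exact ((((Linked.of_adj (Set.mem_insert v _) (hsub (hmem z (by omega) (by omega))) hz).trans
      (hzm.mono hsub)).trans (.of_adj (hsub (hmem m (by omega) (by omega))) (hsub' hr)
      hrm.symm)).trans ((hL.linked r hr r' hr').mono hsub')).trans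
      (.of_adj (hsub' hr') (Or.inr (Set.mem_insert q _)) hrq)
  · rintro a (ha | ha) b hb
    · exact (h.cyc.anti_arc (by omega) (by omega)).symm a ha b hb
    · obtain ⟨k, ⟨k₁, k₂⟩, rfl⟩ := hb
      exact ⟨(hL.ne_rim a ha k).symm, fun c => hno k k₁ k₂ ⟨a, ha, c⟩⟩

/-- The case of `exists_isLone_of_split` in which the sectors of `K` and of `K'` follow one another.
-/
theorem exists_isLone_of_split_aux [Finite V] (h : Wheel G w n v) {K K' : Set V} {p p' : V}
    (hK : IsSplit G w v K K' p p') (hloc : ¬ Local G w n v (K ∪ K')) {i₀ i₁ j₀ j₁ : ℤ}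
    (hs : IsSector G w v i₀ i₁) (hs' : IsSector G w v j₀ j₁)
    (hat : ∀ m, i₁ < m → m < i₀ + n → ¬ Att G K (w m))
    (hat' : ∀ m, j₁ < m → m < j₀ + n → ¬ Att G K' (w m)) (hij : i₁ ≤ j₀) (hji : j₁ < i₀ + n) :
    ∃ i x j, IsLone G w n v i x j ∧
      (Att G K (w (x - 1)) ∨ Att G K (w x) ∨ Att G K (w (x + 1))) := by
  have hn := h.cyc.four_le
  have hlt := hs.lt
  have hlt' := hs'.lt
  have hap : ∀ m, i₁ < m → m < i₀ + n → ¬ G.Adj p (w m) := fun m m₁ m₂ c =>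
    hat m m₁ m₂ ⟨p, hK.mem_left, c⟩
  have hap' : ∀ m, j₁ < m → m < j₀ + n → ¬ G.Adj p' (w m) := fun m m₁ m₂ c =>
    hat' m m₁ m₂ ⟨p', hK.mem_right, c⟩
  have attp : ∀ {m}, Att G (K ∪ K') (w m) → G.Adj p (w m) ∨ Att G K' (w m) := by
    rintro m ⟨x, hx | hx, hxm⟩
    · rcases hK.left x hx with rfl | hx
      · exact Or.inl hxm
      · exact Or.inr ⟨x, hx, hxm⟩
    · exact Or.inr ⟨x, hx, hxm⟩
  have attp' : ∀ {m}, Att G (K ∪ K') (w m) → G.Adj p' (w m) ∨ Att G K (w m) := by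
    rintro m ⟨x, hx | hx, hxm⟩
    · exact Or.inr ⟨x, hx, hxm⟩
    · rcases hK.right x hx with rfl | hx
      · exact Or.inl hxm
      · exact Or.inr ⟨x, hx, hxm⟩
  -- Attachments `e` of `p` and `f` of `p'` that are outside the other sector.
  obtain ⟨e, e₁, e₂, e₃, e₄⟩ : ∃ e, i₀ ≤ e ∧ e ≤ i₁ ∧ e < j₀ ∧ G.Adj p (w e) := by
    by_contra! hc
    refine hloc ⟨j₀, j₁, hs', fun m m₁ m₂ hm => ?_⟩
    have hm := (attp hm).resolve_right (hat' m m₁ m₂)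
    have hmi : i₀ + n ≤ m := by
      by_contra
      exact hap m (by omega) (by omega) hm
    rw [← h.cyc.sub_period] at hm
    have hmi' : m - n ≤ i₁ := by
      by_contra
      exact hap (m - n) (by omega) (by omega) hm
    exact hc (m - n) (by omega) hmi' (by omega) hm
  obtain ⟨f, f₁, f₂, f₃, f₄⟩ : ∃ f, j₀ ≤ f ∧ f ≤ j₁ ∧ i₁ < f ∧ G.Adj p' (w f) := by
    by_contra! hc
    refine hloc ⟨i₀, i₁, hs, fun m m₁ m₂ hm => ?_⟩
    have hm := (attp' hm).resolve_right (hat m m₁ m₂)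
    have hmj : m ≤ j₁ := by
      by_contra
      exact hap' m (by omega) (by omega) hm
    have hmj' : j₀ ≤ m := by
      by_contra
      refine hap' (m + n) (by omega) (by omega) ?_
      rwa [h.cyc.add_period]
    exact hc m hmj' hmj m₁ hm
  obtain ⟨a, a₁, -, a₃, a₄⟩ := h.cyc.exists_next (G.Adj p) ⟨e, e₄⟩ (i₀ - 1)
  obtain ⟨b, b₁, -, b₃, b₄⟩ := h.cyc.exists_prev (G.Adj p) ⟨e, e₄⟩ (i₁ + 1)
  obtain ⟨c, c₁, -, c₃, c₄⟩ := h.cyc.exists_next (G.Adj p') ⟨f, f₄⟩ (j₀ - 1)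
  obtain ⟨d, d₁, -, d₃, d₄⟩ := h.cyc.exists_prev (G.Adj p') ⟨f, f₄⟩ (j₁ + 1)
  have hae : a ≤ e := by
    by_contra
    exact a₄ e (by omega) (by omega) e₄
  have heb : e ≤ b := by
    by_contra
    exact b₄ e (by omega) (by omega) e₄
  have hcf : c ≤ f := by
    by_contra
    exact c₄ f (by omega) (by omega) f₄
  have hfd : f ≤ d := by
    by_contra
    exact d₄ f (by omega) (by omega) f₄
  have attK : ∀ {m}, G.Adj p (w m) → Att G (K ∪ K') (w m) := fun hm =>
    ⟨p, Or.inl hK.mem_left, hm⟩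
  have attK' : ∀ {m}, G.Adj p' (w m) → Att G (K ∪ K') (w m) := fun hm =>
    ⟨p', Or.inr hK.mem_right, hm⟩
  -- Between consecutive attachments, one of `p` and one of `p'`, the spokes are consecutive.
  have hY : ∀ i k j, d ≤ i → i < k → k < j → j ≤ a + n → G.Adj v (w i) → G.Adj v (w j) →
      G.Adj v (w k) := fun i k j h₁ h₂ h₃ h₄ => by
    refine h.spokes_consecutive hK.away hloc (attK' d₃)
      (by rw [h.cyc.add_period]; exact attK a₃) (fun m m₁ m₂ hm => ?_) h₁ h₂ h₃ h₄
    rcases attp' hm with hm' | hm'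
    · rcases le_or_gt m j₁ with y | y
      · exact d₄ m m₁ (by omega) hm'
      · exact hap' m y (by omega) hm'
    · have hmi : i₀ + n ≤ m := by
        by_contra
        exact hat m (by omega) (by omega) hm'
      rcases attp hm with hm | hm
      · exact a₄ (m - n) (by omega) (by omega) (by rwa [h.cyc.sub_period])
      · exact hat' m (by omega) (by omega) hm
  have hX : i₁ < j₀ ∨ ¬ Att G K (w i₁) → ∀ i k j, b ≤ i → i < k → k < j → j ≤ c →
      G.Adj v (w i) → G.Adj v (w j) → G.Adj v (w k) := fun hor i k j h₁ h₂ h₃ h₄ => by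
    refine h.spokes_consecutive hK.away hloc (attK b₃) (attK' c₃) (fun m m₁ m₂ hm => ?_)
      h₁ h₂ h₃ h₄
    rcases attp' hm with hm' | hm'
    · rcases lt_or_ge m j₀ with y | y
      · refine hap' (m + n) (by omega) (by omega) ?_
        rwa [h.cyc.add_period]
      · exact c₄ m (by omega) m₂ hm'
    · have hmi : m ≤ i₁ := by
        by_contra
        exact hat m (by omega) (by omega) hm'
      rcases attp hm with hm | hm
      · exact b₄ m m₁ (by omega) hm
      · have hmj : m < j₀ := by
          rcases hor with y | y
          · omega
          · rcases eq_or_lt_of_le hmi with rfl | y'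
            · exact absurd hm' y
            · omega
        refine hat' (m + n) (by omega) (by omega) ?_
        rwa [h.cyc.add_period]
  have hi₀n : G.Adj v (w (i₀ + n)) := by rw [h.cyc.add_period]; exact hs.left
  have hi₁n : G.Adj v (w (i₁ + n)) := by rw [h.cyc.add_period]; exact hs.right
  -- Outside the two sectors everything is a spoke, hence both sectors are long.
  have hsp : ∀ m, j₁ ≤ m → m ≤ i₀ + n → G.Adj v (w m) := by
    intro m m₁ m₂
    rcases (show m = j₁ ∨ m = i₀ + n ∨ (j₁ < m ∧ m < i₀ + n) by omega) with rfl | rfl | y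
    · exact hs'.right
    · exact hi₀n
    · exact hY _ _ _ (by omega) y.1 y.2 (by omega) hs'.right hi₀n
  have hsp' : ∀ m, i₁ ≤ m → m ≤ j₀ → G.Adj v (w m) := by
    intro m m₁ m₂
    rcases (show m = i₁ ∨ m = j₀ ∨ (i₁ < m ∧ m < j₀) by omega) with rfl | rfl | y
    · exact hs.right
    · exact hs'.left
    · exact hX (Or.inl (by omega)) _ _ _ (by omega) y.1 y.2 (by omega) hs.right hs'.left
  obtain ⟨k, k₁, k₂, k₃⟩ : ∃ k, i₀ < k ∧ k < i₁ ∧ ¬ G.Adj v (w k) := by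
    obtain ⟨m, m₁, m₂, m₃⟩ := h.exists_nonspoke hs'
    have hm₁ : i₀ + n < m := by
      by_contra
      exact m₃ (hsp m (by omega) (by omega))
    rw [← h.cyc.sub_period] at m₃
    have hm₂ : m - n < i₁ := by
      by_contra
      exact m₃ (hsp' (m - n) (by omega) (by omega))
    exact ⟨m - n, by omega, hm₂, m₃⟩
  obtain ⟨k', k₁', k₂', k₃'⟩ : ∃ k, j₀ < k ∧ k < j₁ ∧ ¬ G.Adj v (w k) := by
    obtain ⟨m, m₁, m₂, m₃⟩ := h.exists_nonspoke hs
    have hm₁ : j₀ < m := by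
      by_contra
      exact m₃ (hsp' m (by omega) (by omega))
    have hm₂ : m < j₁ := by
      by_contra
      exact m₃ (hsp m (by omega) (by omega))
    exact ⟨m, hm₁, hm₂, m₃⟩
  obtain ⟨z, z₁, z₂, hz⟩ := h.exists_far_spoke hs (by omega)
  have hz' : z ≤ j₀ ∨ j₁ ≤ z := by
    by_contra
    exact hs'.not_adj z (by omega) (by omega) hz
  rcases eq_or_lt_of_le hij with hij | hij
  · subst hij
    refine ⟨i₀, i₁, j₁, ⟨by omega, by omega, by omega, hs.right, hs.not_adj, hs'.not_adj, hsp⟩, ?_⟩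
    by_contra! hc
    obtain ⟨hc₁, hc₂, -⟩ := hc
    have hb : b + 2 ≤ i₁ := by
      by_contra
      rcases (show b = i₁ - 1 ∨ b = i₁ by omega) with rfl | rfl
      · exact hc₁ ⟨p, hK.mem_left, b₃⟩
      · exact hc₂ ⟨p, hK.mem_left, b₃⟩
    have hc : c < j₁ := by
      by_contra
      exact k₃' (hX (Or.inr hc₂) i₁ k' j₁ (by omega) k₁' k₂' (by omega) hs.right hs'.right)
    refine h.false_of_far_att hs' (by omega) hK.away_left (q := p')
      (hK.away_right.singleton hK.mem_right) hK.adj_right (fun m m₁ m₂ => ?_)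
      (m := a + n) (by omega) (by omega) (by rw [h.cyc.add_period]; exact ⟨p, hK.mem_left, a₃⟩)
      f₃ f₂ f₄ (by omega) hc c₃
    rcases eq_or_lt_of_le m₁ with rfl | y
    · exact hc₂
    · exact hat m y (by omega)
  · exfalso
    have hd : j₀ < d := by
      by_contra
      exact k₃' (hY j₀ k' j₁ (by omega) k₁' k₂' (by omega) hs'.left hs'.right)
    have hc : c < j₁ := by
      by_contra
      exact k₃' (hX (Or.inl hij) j₀ k' j₁ (by omega) k₁' k₂' (by omega) hs'.left hs'.right)
    have hb : i₀ < b := by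
      by_contra
      exact k₃ (hX (Or.inl hij) i₀ k i₁ (by omega) k₁ k₂ (by omega) hs.left hs.right)
    have ha : a < i₁ := by
      by_contra
      refine k₃ ?_
      have := hY (i₀ + n) (k + n) (i₁ + n) (by omega) (by omega) (by omega) (by omega) hi₀n hi₁n
      rwa [h.cyc.add_period] at this
    obtain ⟨m, m₁, m₂, m₃⟩ : ∃ m, i₁ + 2 ≤ m ∧ m + 2 ≤ i₀ + n ∧ G.Adj p' (w m) := by
      rcases le_or_gt (d + 2) (i₀ + n) with y | y
      · exact ⟨d, by omega, y, d₃⟩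
      · exact ⟨c, by omega, by omega, c₃⟩
    refine h.false_of_far_att hs (by omega) hK.away_right (q := p)
      (hK.away_left.singleton hK.mem_left) hK.adj_left (fun l l₁ l₂ hl => ?_) m₁ m₂
      ⟨p', hK.mem_right, m₃⟩ hb (by omega) b₃ (by omega) ha a₃
    refine hat' (l + n) (by omega) (by omega) ?_
    rwa [h.cyc.add_period]

/-- If a path is not local but becomes local when either of its ends is removed, then there is an
isolated spoke `x`, and the path without its last vertex is attached to `x` or to one of the rim
neighbours of `x`. -/
theorem exists_isLone_of_split [Finite V] (h : Wheel G w n v) {K K' : Set V} {p p' : V}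
    (hK : IsSplit G w v K K' p p') (hloc : ¬ Local G w n v (K ∪ K'))
    (hl : Local G w n v K) (hl' : Local G w n v K') :
    ∃ i x j, IsLone G w n v i x j ∧
      (Att G K (w (x - 1)) ∨ Att G K (w x) ∨ Att G K (w (x + 1))) := by
  have hn := h.cyc.four_le
  obtain ⟨i₀, i₁, hs, hat⟩ := hl
  obtain ⟨j₀, j₁, j₂, j₃, hs', hat'⟩ := hl'.exists_window h.cyc i₀
  have hlt := hs.lt
  have hlt' := hs'.lt
  have hle := h.sector_le hs
  rcases eq_or_lt_of_le j₂ with rfl | j₂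
  · exfalso
    have : i₁ = j₁ := by
      rcases lt_trichotomy i₁ j₁ with c | c | c
      · exact absurd hs.right (hs'.not_adj i₁ hlt c)
      · exact c
      · exact absurd hs'.right (hs.not_adj j₁ hlt' c)
    subst this
    refine hloc ⟨i₀, i₁, hs, ?_⟩
    rintro m m₁ m₂ ⟨x, hx | hx, hxm⟩
    · exact hat m m₁ m₂ ⟨x, hx, hxm⟩
    · exact hat' m m₁ m₂ ⟨x, hx, hxm⟩
  · have hij : i₁ ≤ j₀ := by
      by_contra
      exact hs.not_adj j₀ j₂ (by omega) hs'.left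
    have hji : j₁ ≤ i₀ + n := by
      by_contra
      refine hs'.not_adj (i₀ + n) (by omega) (by omega) ?_
      rw [h.cyc.add_period]
      exact hs.left
    rcases eq_or_lt_of_le hji with hji | hji
    · have hij' : i₁ < j₀ := by
        by_contra
        obtain ⟨m, m₁, m₂, m₃⟩ := h.third i₀ i₁
        obtain ⟨a, a₁, a₂, a₃⟩ := h.cyc.exists_window i₀ m
        rw [← a₃] at m₁ m₂ m₃
        have c₁ : a ≠ i₀ := fun e => m₂ (by rw [e])
        have c₂ : a ≠ i₁ := fun e => m₃ (by rw [e])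
        rcases lt_or_ge a i₁ with c | c
        · exact hs.not_adj a (by omega) c m₁
        · exact hs'.not_adj a (by omega) (by omega) m₁
      have hr : IsSector G (fun i => w (-i)) v (-j₁ + n * 1) (-j₀ + n * 1) :=
        hs'.reflect.add_mul_period h.cyc.reflect 1
      obtain ⟨i, x, j, hL, hA⟩ := h.reflect.exists_isLone_of_split_aux hK.reflect
        (not_local_reflect h hloc) hs.reflect hr
        (fun m m₁ m₂ hm => hat (-m + n) (by omega) (by omega) (by rwa [h.cyc.add_period]))
        (fun m m₁ m₂ hm => hat' (-m + n + n) (by omega) (by omega)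
          (by rwa [h.cyc.add_period, h.cyc.add_period])) (by omega) (by omega)
      refine ⟨-j, -x, -i, (hL.reflect h.reflect.cyc).congr (reflect_reflect w) rfl rfl rfl, ?_⟩
      rw [show -x - 1 = -(x + 1) by ring, show -x + 1 = -(x - 1) by ring]
      tauto
    · exact h.exists_isLone_of_split_aux hK hloc hs hs' hat hat' hij hji

end Wheel

/-! ### Walks around the wheel -/

theorem Local.mono {P Q : Set V} (h : Local G w n v Q) (hPQ : P ⊆ Q) : Local G w n v P := by
  obtain ⟨i, j, hs, hm⟩ := h
  exact ⟨i, j, hs, fun m m₁ m₂ hc => hm m m₁ m₂ (hc.mono hPQ)⟩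

theorem away_image_Icc {q : ℕ → V} {t : ℕ} (hadj : ∀ m < t, G.Adj (q m) (q (m + 1)))
    (hrim : ∀ m ≤ t, ∀ i, w i ≠ q m) (hhub : ∀ m ≤ t, q m ≠ v ∧ ¬ G.Adj v (q m)) {a b : ℕ}
    (hb : b ≤ t) : Away G w v (q '' Set.Icc a b) where
  linked := by
    rintro _ ⟨r, ⟨r₁, r₂⟩, rfl⟩ _ ⟨s, ⟨s₁, s₂⟩, rfl⟩
    rcases le_total r s with c | c
    · exact linked_of_seq q c (fun m _ _ => hadj m (by omega))
        fun m m₁ m₂ => ⟨m, ⟨by omega, by omega⟩, rfl⟩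
    · exact (linked_of_seq (A := q '' Set.Icc a b) q c (fun m _ _ => hadj m (by omega))
        fun m m₁ m₂ => ⟨m, ⟨by omega, by omega⟩, rfl⟩).symm
  ne_rim := by
    rintro _ ⟨r, ⟨r₁, r₂⟩, rfl⟩
    exact hrim r (by omega)
  ne_hub := by
    rintro _ ⟨r, ⟨r₁, r₂⟩, rfl⟩
    exact (hhub r (by omega)).1
  not_adj := by
    rintro _ ⟨r, ⟨r₁, r₂⟩, rfl⟩
    exact (hhub r (by omega)).2

/-- In a walk which is not local, consider the first initial segment which is not local and a
shortest final part of it which is not local. It is a clone of an isolated spoke `x`, or it has at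
least two vertices and, without its last vertex, is attached to `x` or to a rim neighbour
of `x`. -/
theorem Wheel.exists_isLone_of_seq [Finite V] (h : Wheel G w n v) {q : ℕ → V} {t : ℕ}
    (hadj : ∀ m < t, G.Adj (q m) (q (m + 1))) (hrim : ∀ m ≤ t, ∀ i, w i ≠ q m)
    (hhub : ∀ m ≤ t, q m ≠ v ∧ ¬ G.Adj v (q m)) (hloc : ¬ Local G w n v (q '' Set.Icc 0 t)) :
    ∃ l ≤ t, (∀ l' < l, Local G w n v (q '' Set.Icc 0 l')) ∧ ∃ i x j, IsLone G w n v i x j ∧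
      (IsClone G w n (q l) x ∨ 0 < l ∧ (Att G (q '' Set.Icc 0 (l - 1)) (w (x - 1)) ∨
        Att G (q '' Set.Icc 0 (l - 1)) (w x) ∨ Att G (q '' Set.Icc 0 (l - 1)) (w (x + 1)))) := by
  classical
  have hex : ∃ l, ¬ Local G w n v (q '' Set.Icc 0 l) := ⟨t, hloc⟩
  set l := Nat.find hex with hl
  have hl₁ : ¬ Local G w n v (q '' Set.Icc 0 l) := Nat.find_spec hex
  have hlt : l ≤ t := Nat.find_min' hex hloc
  have hl₂ : ∀ l' < l, Local G w n v (q '' Set.Icc 0 l') := fun l' hl' => by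
    have := Nat.find_min hex hl'
    rwa [not_not] at this
  refine ⟨l, hlt, hl₂, ?_⟩
  set a := Nat.findGreatest (fun a => ¬ Local G w n v (q '' Set.Icc a l)) l with ha
  have ha₁ : ¬ Local G w n v (q '' Set.Icc a l) :=
    Nat.findGreatest_spec (P := fun a => ¬ Local G w n v (q '' Set.Icc a l)) (Nat.zero_le l) hl₁
  have hal : a ≤ l := Nat.findGreatest_le l
  have haw : ∀ a b, b ≤ l → Away G w v (q '' Set.Icc a b) := fun a b hb =>
    away_image_Icc hadj hrim hhub (by omega)
  rcases eq_or_lt_of_le hal with e | e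
  · rw [e, Set.Icc_self, Set.image_singleton] at ha₁
    have := haw l l le_rfl
    rw [Set.Icc_self, Set.image_singleton] at this
    obtain ⟨i, x, j, h₁, h₂⟩ := h.exists_isClone this ha₁
    exact ⟨i, x, j, h₁, Or.inl h₂⟩
  · have hunion : q '' Set.Icc a (l - 1) ∪ q '' Set.Icc (a + 1) l = q '' Set.Icc a l := by
      rw [← Set.image_union]
      congr 1
      ext m
      simp only [Set.mem_union, Set.mem_Icc]
      omega
    have hsplit : IsSplit G w v (q '' Set.Icc a (l - 1)) (q '' Set.Icc (a + 1) l) (q a) (q l) := by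
      refine ⟨hunion ▸ haw a l le_rfl, haw _ _ (by omega), haw _ _ le_rfl,
        ⟨a, ⟨le_rfl, by omega⟩, rfl⟩, ⟨l, ⟨by omega, le_rfl⟩, rfl⟩, ?_, ?_,
        ⟨q (a + 1), ⟨a + 1, ⟨le_rfl, by omega⟩, rfl⟩, (hadj a (by omega)).symm⟩,
        ⟨q (l - 1), ⟨l - 1, ⟨by omega, le_rfl⟩, rfl⟩, ?_⟩⟩
      · rintro _ ⟨m, ⟨m₁, m₂⟩, rfl⟩
        rcases eq_or_lt_of_le m₁ with rfl | c
        · exact Or.inl rfl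
        · exact Or.inr ⟨m, ⟨c, by omega⟩, rfl⟩
      · rintro _ ⟨m, ⟨m₁, m₂⟩, rfl⟩
        rcases eq_or_lt_of_le m₂ with rfl | c
        · exact Or.inl rfl
        · exact Or.inr ⟨m, ⟨by omega, by omega⟩, rfl⟩
      · have := hadj (l - 1) (by omega)
        rwa [show l - 1 + 1 = l by omega] at this
    have hsub : q '' Set.Icc a (l - 1) ⊆ q '' Set.Icc 0 (l - 1) :=
      Set.image_mono (Set.Icc_subset_Icc_left (Nat.zero_le a))
    have hK' : Local G w n v (q '' Set.Icc (a + 1) l) := by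
      have := Nat.findGreatest_is_greatest (P := fun a => ¬ Local G w n v (q '' Set.Icc a l))
        (show a < a + 1 by omega) (by omega)
      rwa [not_not] at this
    obtain ⟨i, x, j, h₁, h₂⟩ := h.exists_isLone_of_split hsplit (by rwa [hunion])
      ((hl₂ (l - 1) (by omega)).mono hsub) hK'
    exact ⟨i, x, j, h₁, Or.inr ⟨by omega,
      h₂.imp (·.mono hsub) (Or.imp (·.mono hsub) (·.mono hsub))⟩⟩

/-- A shortest walk inside `D` from `A` to `B` meets these sets only in its ends. -/
theorem exists_seq_between {D A B : Set V} {x y : V} (hx : x ∈ A) (hy : y ∈ B)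
    (hxy : Linked G D x y) :
    ∃ (f : ℕ → V) (t : ℕ), f 0 ∈ A ∧ f t ∈ B ∧ (∀ m < t, G.Adj (f m) (f (m + 1))) ∧
      (∀ m ≤ t, f m ∈ D) ∧ ∀ m, 0 < m → m < t → f m ∉ A ∧ f m ∉ B := by
  classical
  have hex : ∃ t, ∃ f : ℕ → V, f 0 ∈ A ∧ f t ∈ B ∧ (∀ m < t, G.Adj (f m) (f (m + 1))) ∧
      ∀ m ≤ t, f m ∈ D := by
    obtain ⟨f, t, rfl, rfl, h₁, h₂⟩ := hxy.exists_seq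
    exact ⟨t, f, hx, hy, h₁, h₂⟩
  obtain ⟨f, hA, hB, hadj, hD⟩ := Nat.find_spec hex
  have hmin := fun {t} => Nat.find_min' hex (m := t)
  set t := Nat.find hex
  refine ⟨f, t, hA, hB, hadj, hD, fun m m₁ m₂ => ⟨fun hc => ?_, fun hc => ?_⟩⟩
  · have := hmin (t := t - m) ⟨fun r => f (m + r), hc, by
      change f (m + (t - m)) ∈ B
      rwa [show m + (t - m) = t by omega], fun r hr => hadj (m + r) (by omega),
      fun r hr => hD _ (by omega)⟩
    omega
  · have := hmin (t := m) ⟨f, hA, hc, fun r hr => hadj r (by omega), fun r hr => hD r (by omega)⟩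
    omega

theorem IsSector.unique {i j i' j' a : ℤ} (h : IsSector G w v i j) (h' : IsSector G w v i' j')
    (h₁ : i < a) (h₂ : a < j) (h₃ : i' < a) (h₄ : a < j') : i = i' ∧ j = j' := by
  constructor
  · rcases lt_trichotomy i i' with c | c | c
    · exact absurd h'.left (h.not_adj i' c (by omega))
    · exact c
    · exact absurd h.left (h'.not_adj i c (by omega))
  · rcases lt_trichotomy j j' with c | c | c
    · exact absurd h.right (h'.not_adj j (by omega) c)
    · exact c
    · exact absurd h'.right (h.not_adj j' (by omega) c)

/-! ### Connected sets surrounding a wheel -/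

/-- `D` is a connected set avoiding the closed neighbourhood of the hub whose closed neighbourhood
contains the rim. -/
structure Surrounds (G : SimpleGraph V) (w : ℤ → V) (v : V) (D : Set V) : Prop where
  linked : ∀ x ∈ D, ∀ y ∈ D, Linked G D x y
  hub : ∀ x ∈ D, x ≠ v ∧ ¬ G.Adj v x
  mem : ∀ i, ¬ G.Adj v (w i) → w i ∈ D
  spoke : ∀ i, G.Adj v (w i) → ∃ d ∈ D, G.Adj d (w i)

namespace Wheel

/-- A shortest walk in `D` from the interior of a long sector to the rest of the rim is not local,
and this provides an isolated spoke. -/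
theorem exists_isLone [Finite V] (h : Wheel G w n v) {D : Set V} (hD : Surrounds G w v D) :
    ∃ i x j, IsLone G w n v i x j := by
  have hn := h.cyc.four_le
  obtain ⟨-, k, -, -, -, -, -, -, -, hk, -, -⟩ := h.gaps
  obtain ⟨i, i₁, -, i₃, i₄⟩ := h.cyc.exists_prev (G.Adj v) h.exists_spoke k
  obtain ⟨j, j₁, -, j₃, j₄⟩ := h.cyc.exists_next (G.Adj v) h.exists_spoke k
  have hs : IsSector G w v i j := ⟨by omega, i₃, j₃, fun m m₁ m₂ => by
    rcases lt_trichotomy m k with c | rfl | c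
    · exact i₄ m m₁ c
    · exact hk
    · exact j₄ m c m₂⟩
  have hle := h.sector_le hs
  obtain ⟨k', k₁', k₂', hk'⟩ := h.exists_nonspoke hs
  set A : Set V := w '' Set.Ioo i j with hA
  obtain ⟨f, t, hf₀, ⟨⟨b, hb⟩, hbA⟩, hadj, hfD, hint⟩ := exists_seq_between (A := A)
    (B := Set.range w \ A) (x := w k) (y := w k') ⟨k, ⟨i₁, j₁⟩, rfl⟩ (by
      refine ⟨⟨k', rfl⟩, ?_⟩
      rintro ⟨m, ⟨m₁, m₂⟩, hm⟩
      rw [h.cyc.eq_iff (by omega) (by omega)] at hm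
      omega) (hD.linked _ (hD.mem k hk) _ (hD.mem k' hk'))
  obtain ⟨a, ⟨a₁, a₂⟩, ha⟩ := hf₀
  have hvb : ¬ G.Adj v (w b) := by
    rw [hb]
    exact (hD.hub _ (hfD t le_rfl)).2
  have ht₂ : 2 ≤ t := by
    by_contra
    rcases (show t = 0 ∨ t = 1 by omega) with rfl | rfl
    · exact hbA ⟨a, ⟨a₁, a₂⟩, ha⟩
    · have hab := hadj 0 (by omega)
      rw [← ha, zero_add, ← hb] at hab
      obtain ⟨m, m₁, m₂, m₃⟩ : ∃ m, i ≤ m ∧ m ≤ j ∧ w b = w m := by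
        rcases h.cyc.adj_imp hab with c | c
        · exact ⟨a + 1, by omega, by omega, c⟩
        · exact ⟨a - 1, by omega, by omega, c⟩
      rw [m₃] at hvb
      refine hbA ⟨m, ⟨lt_of_le_of_ne m₁ ?_, lt_of_le_of_ne m₂ ?_⟩, m₃.symm.trans hb⟩
      · rintro rfl
        exact hvb i₃
      · rintro rfl
        exact hvb j₃
  have hrim : ∀ m ≤ t - 2, ∀ r, w r ≠ f (m + 1) := by
    intro m hm r hr
    have := hint (m + 1) (by omega) (by omega)
    exact this.2 ⟨⟨r, hr⟩, this.1⟩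
  -- The walk is attached to the interiors of two different long sectors.
  have hloc : ¬ Local G w n v ((fun m => f (m + 1)) '' Set.Icc 0 (t - 2)) := by
    rintro ⟨i', j', hs', hno⟩
    have hle' := h.sector_le hs'
    have key : ∀ c, ¬ G.Adj v (w c) → Att G ((fun m => f (m + 1)) '' Set.Icc 0 (t - 2)) (w c) →
        ∃ c', i' < c' ∧ c' < j' ∧ w c' = w c := by
      intro c hc hatt
      obtain ⟨c', c₁, c₂, c₃⟩ := h.cyc.exists_window i' c
      rw [← c₃] at hc hatt
      have d₁ : c' ≠ i' := fun e => hc (e ▸ hs'.left)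
      have d₂ : c' ≠ j' := fun e => hc (e ▸ hs'.right)
      refine ⟨c', by omega, ?_, c₃⟩
      by_contra
      exact hno c' (by omega) c₂ hatt
    obtain ⟨a', a₁', a₂', ha'⟩ := key a (hs.not_adj a a₁ a₂)
      ⟨f 1, ⟨0, ⟨le_rfl, by omega⟩, rfl⟩, by rw [ha]; exact (hadj 0 (by omega)).symm⟩
    obtain ⟨b', b₁', b₂', hb'⟩ := key b hvb ⟨f (t - 1), ⟨t - 2, ⟨by omega, le_rfl⟩, by
      change f (t - 2 + 1) = f (t - 1)
      congr 1
      omega⟩, by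
      have := hadj (t - 1) (by omega)
      rw [show t - 1 + 1 = t by omega] at this
      rwa [hb]⟩
    obtain ⟨c, hc⟩ := (h.cyc.eq_iff_dvd _ _).mp ha'.symm
    have hs'' := hs.add_mul_period h.cyc c
    obtain ⟨e₁, e₂⟩ := hs''.unique hs' (a := a') (by omega) (by omega) a₁' a₂'
    refine hbA ⟨b' - n * c, ⟨by omega, by omega⟩, ?_⟩
    rw [← hb, ← hb', ← h.cyc.add_mul_period (b' - n * c) c, sub_add_cancel]
  obtain ⟨l, -, -, i', x, j', hL, -⟩ := h.exists_isLone_of_seq (q := fun m => f (m + 1))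
    (t := t - 2) (fun m hm => hadj (m + 1) (by omega)) hrim
    (fun m hm => hD.hub _ (hfD _ (by omega))) hloc
  exact ⟨i', x, j', hL⟩

/-- The isolated spoke in `IsLone` is unique up to the period. -/
theorem isLone_unique (h : Wheel G w n v) {i x j i' x' j' : ℤ} (hL : IsLone G w n v i x j)
    (hL' : IsLone G w n v i' x' j') : ∃ c, x' = x + n * c := by
  have l₁ := hL.left_le
  have l₂ := hL.right_le
  have l₃ := hL.far_le
  have l₁' := hL'.left_le
  have l₂' := hL'.right_le
  obtain ⟨y, y₁, y₂, y₃⟩ := h.cyc.exists_window j x'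
  obtain ⟨c, hc⟩ := (h.cyc.eq_iff_dvd _ _).mp y₃.symm
  have per := h.cyc.add_mul_period
  have n₁ : ¬ G.Adj v (w (y - 1)) := by
    rw [show y - 1 = x' - 1 + n * c by omega, per]
    exact hL'.left _ (by omega) (by omega)
  have n₂ : ¬ G.Adj v (w (y + 1)) := by
    rw [show y + 1 = x' + 1 + n * c by omega, per]
    exact hL'.right _ (by omega) (by omega)
  have hy : G.Adj v (w y) := y₃ ▸ hL'.spoke
  have hyi : i + n < y := by
    by_contra
    rcases lt_or_ge y (i + n) with d | d
    · exact n₂ (hL.far _ (by omega) (by omega))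
    · exact n₁ (hL.far _ (by omega) (by omega))
  rw [← h.cyc.sub_period] at hy
  have : y = x + n := by
    rcases lt_trichotomy y (x + n) with d | d | d
    · exact absurd hy (hL.left _ (by omega) (by omega))
    · exact d
    · exact absurd hy (hL.right _ (by omega) (by omega))
  exact ⟨1 - c, by rw [mul_sub]; omega⟩

/-- A local set attached to a spoke inside the far arc of `IsLone` is attached only to the ends of
one edge of this arc, as all vertices there are spokes. -/
theorem exists_edge_of_local (h : Wheel G w n v) {i x j : ℤ} (hL : IsLone G w n v i x j)
    {P : Set V} (hP : Local G w n v P) (hatt : Att G P (w (j + 1))) :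
    ∃ e, j ≤ e ∧ e ≤ j + 1 ∧ ∀ m, e + 1 < m → m < e + n → ¬ Att G P (w m) := by
  have l₃ := hL.far_le
  obtain ⟨a, b, a₁, a₂, hs, hno⟩ := hP.exists_window h.cyc (j + 2 - n)
  have hlt := hs.lt
  have hjb : j + 1 ≤ b := by
    by_contra
    exact hno (j + 1) (by omega) (by omega) hatt
  have hja : j ≤ a := by
    by_contra
    exact hs.not_adj j (by omega) (by omega) (hL.far j le_rfl (by omega))
  have hb : b = a + 1 := by
    by_contra
    exact hs.not_adj (a + 1) (by omega) (by omega) (hL.far _ (by omega) (by omega))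
  subst hb
  exact ⟨a, hja, by omega, hno⟩

/-- Replacing the isolated spoke `x` by a clone `u` gives a hole; a path from `u` to an edge of the
opposite arc then makes a theta or a pyramid. -/
theorem false_of_isClone (h : Wheel G w n v) {x e : ℤ} {u : V}
    (hu : Away G w v {u}) (hc : IsClone G w n u x) (he₁ : x + 2 ≤ e) (he₂ : e + 3 ≤ x + n)
    {q : ℕ → V} {k : ℕ} (hadj : ∀ m < k, G.Adj (q m) (q (m + 1))) (hku : G.Adj (q k) u)
    (hrim : ∀ m ≤ k, ∀ i, w i ≠ q m)
    (hno : ∀ m, e + 1 < m → m < e + n → ¬ Att G (q '' Set.Icc 0 k) (w m))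
    (hex : ∃ m ≤ k, G.Adj (q m) (w e) ∨ G.Adj (q m) (w (e + 1))) : False := by
  classical
  have hn := h.cyc.four_le
  have huw := hu.ne_rim u rfl
  obtain ⟨m₀, hm₀, hm₀'⟩ := hex
  -- The last vertex of the walk attached to the edge.
  set r := Nat.findGreatest (fun m => G.Adj (q m) (w e) ∨ G.Adj (q m) (w (e + 1))) k with hr
  have hrk : r ≤ k := Nat.findGreatest_le k
  have hr₁ : G.Adj (q r) (w e) ∨ G.Adj (q r) (w (e + 1)) :=
    Nat.findGreatest_spec (P := fun m => G.Adj (q m) (w e) ∨ G.Adj (q m) (w (e + 1))) hm₀ hm₀'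
  have hr₂ : ∀ m, r < m → m ≤ k → ¬ G.Adj (q m) (w e) ∧ ¬ G.Adj (q m) (w (e + 1)) :=
    fun m m₁ m₂ => not_or.mp (Nat.findGreatest_is_greatest
      (P := fun m => G.Adj (q m) (w e) ∨ G.Adj (q m) (w (e + 1))) m₁ m₂)
  set L := q '' Set.Icc r k with hL
  have hLw : ∀ z ∈ L, ∀ m, w m ≠ z := by
    rintro _ ⟨s, ⟨s₁, s₂⟩, rfl⟩ m
    exact hrim s s₂ m
  have hlink : Linked G L (q r) (q k) := linked_of_seq q hrk (fun m _ m₂ => hadj m m₂)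
    fun m m₁ m₂ => ⟨m, ⟨m₁, m₂⟩, rfl⟩
  have hkL : q k ∈ L := ⟨k, ⟨hrk, le_rfl⟩, rfl⟩
  have hrL : q r ∈ L := ⟨r, ⟨le_rfl, hrk⟩, rfl⟩
  have hLno : ∀ z ∈ L, ∀ m, x + 1 ≤ m → m ≤ x + n - 1 → G.Adj z (w m) →
      z = q r ∧ (m = e ∨ m = e + 1) := by
    rintro _ ⟨s, ⟨s₁, s₂⟩, rfl⟩ m m₁ m₂ hm
    have hatt : Att G (q '' Set.Icc 0 k) (w m) := ⟨q s, ⟨s, ⟨by omega, s₂⟩, rfl⟩, hm⟩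
    have hme : m = e ∨ m = e + 1 := by
      by_contra
      rcases lt_or_ge m e with c | c
      · refine hno (m + n) (by omega) (by omega) ?_
        rwa [h.cyc.add_period]
      · exact hno m (by omega) (by omega) hatt
    refine ⟨?_, hme⟩
    rcases eq_or_lt_of_le s₁ with rfl | c
    · rfl
    · rcases hme with rfl | rfl
      · exact absurd hm (hr₂ s c s₂).1
      · exact absurd hm (hr₂ s c s₂).2
  have hpred : G.Adj u (w (x + n - 1)) := by
    have := hc.pred
    rwa [← h.cyc.add_period, show x - 1 + n = x + n - 1 by ring] at this
  have hue : ∀ m, e ≤ m → m ≤ e + 1 → ¬ G.Adj u (w m) := fun m m₁ m₂ =>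
    hc.not_adj m (by omega) (by omega)
  -- If the walk meets the edge in only one end `w ε`, there is a theta with ends `u` and `w ε`.
  have htheta : ∀ ε, e ≤ ε → ε ≤ e + 1 → G.Adj (q r) (w ε) →
      (∀ m, e ≤ m → m ≤ e + 1 → m ≠ ε → ¬ G.Adj (q r) (w m)) → False := by
    intro ε ε₁ ε₂ hε hε'
    refine h.theta (containsTheta_of_sets (a := u) (b := w ε) (A := w '' Set.Icc (x + 1) (ε - 1))
      (B := w '' Set.Icc (ε + 1) (x + n - 1)) (C := L) (huw _).symm (hue ε ε₁ ε₂) ?_ ?_ ?_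
      (h.cyc.anti_arc (by omega) (by omega)) ?_ ?_)
    · refine Linked.trans (.of_adj (by simp) ?_ hc.succ) (h.cyc.linked_arc (by omega) ?_)
      · exact Or.inr (Or.inr ⟨x + 1, ⟨le_rfl, by omega⟩, rfl⟩)
      · intro m m₁ m₂
        rcases eq_or_lt_of_le m₂ with rfl | m₃
        · simp
        · exact Or.inr (Or.inr ⟨m, ⟨m₁, by omega⟩, rfl⟩)
    · refine Linked.trans (.of_adj (by simp) ?_ hpred) (h.cyc.linked_arc (by omega) ?_).symm
      · exact Or.inr (Or.inr ⟨x + n - 1, ⟨by omega, le_rfl⟩, rfl⟩)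
      · intro m m₁ m₂
        rcases eq_or_lt_of_le m₁ with rfl | m₃
        · simp
        · exact Or.inr (Or.inr ⟨m, ⟨by omega, m₂⟩, rfl⟩)
    · have hsub : L ⊆ insert u (insert (w ε) L) := fun z hz => Or.inr (Or.inr hz)
      exact ((Linked.of_adj (Set.mem_insert u _) (hsub hkL) hku.symm).trans
        (hlink.mono hsub).symm).trans (.of_adj (hsub hrL) (Or.inr (Set.mem_insert _ _)) hε)
    · rintro _ ⟨m, ⟨m₁, m₂⟩, rfl⟩ z hz
      refine ⟨hLw z hz m, fun hm => ?_⟩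
      obtain ⟨rfl, hme⟩ := hLno z hz m (by omega) (by omega) hm.symm
      exact hε' m (by omega) (by omega) (by omega) hm.symm
    · rintro _ ⟨m, ⟨m₁, m₂⟩, rfl⟩ z hz
      refine ⟨hLw z hz m, fun hm => ?_⟩
      obtain ⟨rfl, hme⟩ := hLno z hz m (by omega) (by omega) hm.symm
      exact hε' m (by omega) (by omega) (by omega) hm.symm
  by_cases c₁ : G.Adj (q r) (w e) <;> by_cases c₂ : G.Adj (q r) (w (e + 1))
  · have huL : u ∉ L := fun hc' => by
      have := (hLno u hc' (x + 1) le_rfl (by omega) hc.succ).2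
      omega
    have huarc : ∀ i j, u ∉ w '' Set.Icc i j := by
      rintro i j ⟨m, -, hm⟩
      exact huw m hm
    refine h.pyramid (containsPyramid_of_sets (a := u) (b₁ := q r) (b₂ := w e) (b₃ := w (e + 1))
      (A := L) (B := w '' Set.Icc (x + 1) e) (C := w '' Set.Icc (e + 1) (x + n - 1)) c₁ c₂
      (h.cyc.adj_succ e) huL (huarc _ _) (huarc _ _) hrL ⟨e, ⟨by omega, le_rfl⟩, rfl⟩
      ⟨e + 1, ⟨le_rfl, by omega⟩, rfl⟩ ?_ ?_ ?_ (fun d => hue e le_rfl (by omega) d.2)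
      (fun d => hue (e + 1) (by omega) le_rfl d.2) (fun d => hue e le_rfl (by omega) d.1) ?_ ?_ ?_)
    · exact (Linked.of_adj (Set.mem_insert u _) (Or.inr hkL) hku.symm).trans
        (hlink.mono fun z hz => Or.inr hz).symm
    · refine Linked.trans (.of_adj (by simp) ?_ hc.succ) (h.cyc.linked_arc (by omega) ?_)
      · exact Or.inr ⟨x + 1, ⟨le_rfl, by omega⟩, rfl⟩
      · intro m m₁ m₂
        exact Or.inr ⟨m, ⟨m₁, m₂⟩, rfl⟩
    · refine Linked.trans (.of_adj (by simp) ?_ hpred) (h.cyc.linked_arc (by omega) ?_).symm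
      · exact Or.inr ⟨x + n - 1, ⟨by omega, le_rfl⟩, rfl⟩
      · intro m m₁ m₂
        exact Or.inr ⟨m, ⟨m₁, m₂⟩, rfl⟩
    · rintro z hz _ ⟨m, ⟨m₁, m₂⟩, rfl⟩
      refine ⟨(hLw z hz m).symm, fun hm => ?_⟩
      obtain ⟨hz', hme⟩ := hLno z hz m m₁ (by omega) hm
      exact ⟨hz', by congr 1; omega⟩
    · rintro z hz _ ⟨m, ⟨m₁, m₂⟩, rfl⟩
      refine ⟨(hLw z hz m).symm, fun hm => ?_⟩
      obtain ⟨hz', hme⟩ := hLno z hz m (by omega) m₂ hm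
      exact ⟨hz', by congr 1; omega⟩
    · rintro _ ⟨m, ⟨m₁, m₂⟩, rfl⟩ _ ⟨m', ⟨m₁', m₂'⟩, rfl⟩
      rw [Ne, h.cyc.eq_iff (by omega) (by omega), h.cyc.adj_iff (by omega) (by omega)]
      refine ⟨by omega, fun e' => ?_⟩
      obtain rfl : m = e := by omega
      obtain rfl : m' = m + 1 := by omega
      exact ⟨rfl, rfl⟩
  · refine htheta e le_rfl (by omega) c₁ fun m m₁ m₂ m₃ => ?_
    rwa [show m = e + 1 by omega]
  · refine htheta (e + 1) (by omega) le_rfl c₂ fun m m₁ m₂ m₃ => ?_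
    rwa [show m = e by omega]
  · exact hr₁.elim c₁ c₂

/-- From a spoke inside the arc opposite to the isolated spoke `x`, a shortest walk in `D` leads
back to a non-spoke of the rim, so it is not local. Its shortest initial segment which is not local
ends in a clone of `x`, but before that it is attached to only one edge of the opposite arc. -/
theorem false_of_surrounds [Finite V] (h : Wheel G w n v) {D : Set V}
    (hD : Surrounds G w v D) : False := by
  have hn := h.cyc.four_le
  obtain ⟨i, x, j, hL⟩ := h.exists_isLone hD
  have l₁ := hL.left_le
  have l₂ := hL.right_le
  have l₃ := hL.far_le
  have hspD : ∀ m, G.Adj v (w m) → w m ∉ D := fun m hm hc => (hD.hub _ hc).2 hm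
  -- The spoke at `j + 1` has both rim neighbours among the spokes, so it is attached to `D` from
  -- outside the rim.
  obtain ⟨d, hdD, hd⟩ := hD.spoke (j + 1) (hL.far _ (by omega) (by omega))
  have hdw : d ∉ Set.range w := by
    rintro ⟨m, rfl⟩
    rcases h.cyc.adj_imp hd.symm with c | c
    · refine hspD (j + 1 + 1) (hL.far _ (by omega) (by omega)) (c ▸ hdD)
    · refine hspD (j + 1 - 1) (hL.far _ (by omega) (by omega)) (c ▸ hdD)
  have hx₁ : w (x + 1) ∈ D := hD.mem _ (hL.right _ (by omega) (by omega))
  obtain ⟨q, t, ⟨hq₀w, hq₀⟩, ⟨b, hb⟩, hadj, hqD, hint⟩ := exists_seq_between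
    (A := {z | z ∉ Set.range w ∧ G.Adj z (w (j + 1))}) (B := Set.range w)
    (x := d) (y := w (x + 1)) ⟨hdw, hd⟩ ⟨x + 1, rfl⟩ (hD.linked d hdD _ hx₁)
  have ht : 0 < t := by
    by_contra
    obtain rfl : t = 0 := by omega
    exact hq₀w ⟨b, hb⟩
  have hvb : ¬ G.Adj v (w b) := fun hc => hspD b hc (hb ▸ hqD t le_rfl)
  have hrim : ∀ m ≤ t - 1, ∀ i, w i ≠ q m := by
    intro m hm r hr
    rcases Nat.eq_zero_or_pos m with rfl | c
    · exact hq₀w ⟨r, hr⟩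
    · exact (hint m c (by omega)).2 ⟨r, hr⟩
  have hatt : ∀ l, Att G (q '' Set.Icc 0 l) (w (j + 1)) := fun l =>
    ⟨q 0, ⟨0, ⟨le_rfl, Nat.zero_le l⟩, rfl⟩, hq₀⟩
  have hhub : ∀ m ≤ t - 1, q m ≠ v ∧ ¬ G.Adj v (q m) := fun m hm => hD.hub _ (hqD m (by omega))
  have hloc : ¬ Local G w n v (q '' Set.Icc 0 (t - 1)) := by
    intro hc
    obtain ⟨e, e₁, e₂, hno⟩ := h.exists_edge_of_local hL hc (hatt _)
    obtain ⟨b', b₁, b₂, b₃⟩ := h.cyc.exists_window e b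
    rw [← b₃] at hvb hb
    have c₁ : b' ≠ e := fun c => hvb (by rw [c]; exact hL.far e (by omega) (by omega))
    have c₂ : b' ≠ e + 1 := fun c => hvb (by rw [c]; exact hL.far _ (by omega) (by omega))
    refine hno b' (by omega) b₂ ⟨q (t - 1), ⟨t - 1, ⟨Nat.zero_le _, le_rfl⟩, rfl⟩, ?_⟩
    have := hadj (t - 1) (by omega)
    rwa [show t - 1 + 1 = t by omega, ← hb] at this
  obtain ⟨l, hlt, hl, i', x', j', hL', hcase⟩ := h.exists_isLone_of_seq (t := t - 1)
    (fun m hm => hadj m (by omega)) hrim hhub hloc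
  obtain ⟨c, rfl⟩ := h.isLone_unique hL hL'
  have per := h.cyc.add_mul_period
  rcases hcase with hc | ⟨hl₀, hc⟩
  · have hc' : IsClone G w n (q l) x := by
      refine ⟨?_, ?_, fun m m₁ m₂ => ?_⟩
      · have := hc.pred
        rwa [show x + n * c - 1 = x - 1 + n * c by ring, per] at this
      · have := hc.succ
        rwa [show x + n * c + 1 = x + 1 + n * c by ring, per] at this
      · have := hc.not_adj (m + n * c) (by omega) (by omega)
        rwa [per] at this
    have hl₀ : 0 < l := by
      by_contra
      obtain rfl : l = 0 := by omega
      exact hc'.not_adj (j + 1) (by omega) (by omega) hq₀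
    obtain ⟨e, e₁, e₂, hno⟩ := h.exists_edge_of_local hL (hl (l - 1) (by omega)) (hatt _)
    have haw : Away G w v (q '' Set.Icc 0 l) :=
      away_image_Icc (t := t - 1) (fun m hm => hadj m (by omega)) hrim hhub hlt
    refine h.false_of_isClone (haw.singleton ⟨l, ⟨Nat.zero_le l, le_rfl⟩, rfl⟩) hc'
      (e := e) (by omega) (by omega) (q := q) (k := l - 1) (fun m hm => hadj m (by omega)) ?_
      (fun m hm => hrim m (by omega)) hno ⟨0, Nat.zero_le _, ?_⟩
    · have := hadj (l - 1) (by omega)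
      rwa [show l - 1 + 1 = l by omega] at this
    · rcases (show j + 1 = e ∨ j + 1 = e + 1 by omega) with y | y
      · exact Or.inl (y ▸ hq₀)
      · exact Or.inr (y ▸ hq₀)
  · obtain ⟨e, e₁, e₂, hno⟩ := h.exists_edge_of_local hL (hl (l - 1) (by omega)) (hatt _)
    have key : ∀ m, x - 1 ≤ m → m ≤ x + 1 → ¬ Att G (q '' Set.Icc 0 (l - 1)) (w (m + n * c)) := by
      intro m m₁ m₂
      rw [per, ← h.cyc.add_period]
      exact hno _ (by omega) (by omega)
    rcases hc with hc | hc | hc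
    · exact key (x - 1) (by omega) (by omega) (by convert hc using 2; ring)
    · exact key x (by omega) (by omega) hc
    · exact key (x + 1) (by omega) (by omega) (by convert hc using 2; ring)

end Wheel

theorem linked_supp {K : Set V} (D : G.ComponentCompl K) {x y : V} (hx : x ∈ D.supp)
    (hy : y ∈ D.supp) : Linked G D.supp x y := by
  obtain ⟨hxK, rfl⟩ := hx
  obtain ⟨hyK, hxy⟩ := hy
  obtain ⟨p⟩ := ConnectedComponent.exact hxy.symm
  have main : ∀ (a b : (Kᶜ : Set V)) (p : (G.induce Kᶜ).Walk a b),
      Linked G (G.componentComplMk a.2).supp a b := by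
    intro a b p
    induction p with
    | nil => exact .refl ⟨_, rfl⟩
    | @cons a c b hac q ih =>
      have e := componentComplMk_eq_of_adj G a.2 c.2 hac
      rw [e]
      exact (Linked.of_adj (A := (G.componentComplMk c.2).supp) ⟨a.2, e⟩ ih.left_mem hac).trans ih
  exact main _ _ p

end OptimalWheel

open OptimalWheel in
theorem theorem3p2 {V : Type*} [Finite V] (G : SimpleGraph V) (hG : InClassCStar G)
    (W : Set V) (v : V) (hW : IsOptimalWheel G W v) :
    ¬ ∃ D : G.ComponentCompl (closedNbhd G v), W ⊆ closedNbhdSet G D.supp := by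
  rintro ⟨D, hWD⟩
  obtain ⟨w, n, h, rfl⟩ := Wheel.of_isOptimalWheel hG hW
  have hub : ∀ x ∈ D.supp, x ≠ v ∧ ¬ G.Adj v x := by
    rintro x ⟨hx, -⟩
    exact ⟨fun e => hx (Or.inl e), fun e => hx (Or.inr e)⟩
  refine h.false_of_surrounds (D := D.supp)
    ⟨fun x hx y hy => linked_supp D hx hy, hub, fun i hi => ?_, fun i hi => ?_⟩
  · rcases hWD ⟨i, rfl⟩ with hD | ⟨d, hd, hdi⟩
    · exact hD
    · refine ComponentCompl.mem_of_adj (C := D) d (w i) hd ?_ hdi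
      rintro (e | e)
      · exact h.ne_hub i e
      · exact hi e
  · rcases hWD ⟨i, rfl⟩ with hD | hd
    · exact absurd hi (hub _ hD).2
    · exact hd
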